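/- Let $A$ be a finite dimensional algebra over a field $K$; all modules are finite dimensional right $A$-modules, and $D=\operatorname{Hom}_K(-,K)$. For a module $M$ with minimal injective resolution $0\to M\to I_0\to I_1\to\cdots$, the dominant dimension $\operatorname{domdim}(M)$ is the supremum of all $n\ge 0$ such that $I_0,\dots,I_{n-1}$ are projective, and the codominant dimension is $\operatorname{codomdim}(M)=\operatorname{domdim}(D(M))$. Here $\Omega$ is the syzygy (the kernel of a projective cover), $\Omega^{-1}$ is the cosyzygy (the cokernel of an injective hull), and $\tau=D\operatorname{Tr}$, $\tau^{-1}=\operatorname{Tr}D$ are the Auslander–Reiten translates, where $\operatorname{Tr}(M)$ is the cokernel of $\operatorname{Hom}_A(P_0,A)\to\operatorname{Hom}_A(P_1,A)$ for a minimal projective presentation $P_1\to P_0\to M\to 0$. The algebra $A$ is called gendo-symmetric if $\operatorname{domdim}(A_A)\ge 2$ and $D(Ae)\cong eA$ as $(eAe,A)$-bimodules, where $e$ is an idempotent such that $eA$ is a minimal faithful projective-injective right $A$-module. **Proposition.** Let $A$ be a gendo-symmetric algebra and $M$ an $A$-module. 1. If $\operatorname{codomdim}(M)\ge 2$, then $\tau(M)\cong\Omega^{2}(M)$.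 If every projective direct summand of $M$ is injective (for instance, if $M$ has no nonzero projective direct summand), then $$\operatorname{codomdim}(M)\ge 2\iff \tau(M)\cong\Omega^{2}(M).$$ 2. If $\operatorname{domdim}(M)\ge 2$, then $\tau^{-1}(M)\cong\Omega^{-2}(M)$. If every injective direct summand of $M$ is projective (for instance, if $M$ has no nonzero injective direct summand), then $$\operatorname{domdim}(M)\ge 2\iff \tau^{-1}(M)\cong\Omega^{-2}(M).$$ -/

import Mathlib

universe u

namespace GendoSymm

open MulOpposite

/-! ### Projective covers and injective hulls -/

section Covers

variable {R : Type u} [Ring R]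

/-- `f : P → M` is a projective cover: `P` is projective, `f` is onto, and its kernel is
superfluous. -/
structure IsProjectiveCover {P M : Type u} [AddCommGroup P] [Module R P] [AddCommGroup M]
    [Module R M] (f : P →ₗ[R] M) : Prop where
  projective : Module.Projective R P
  surjective : Function.Surjective f
  superfluous : ∀ N : Submodule R P, N ⊔ LinearMap.ker f = ⊤ → N = ⊤

/-- `f : M → I` is an injective hull: `I` is injective, `f` is one-to-one, and its image is
essential. -/
structure IsInjectiveHull {M I : Type u} [AddCommGroup M] [Module R M] [AddCommGroup I]
    [Module R I] (f : M →ₗ[R] I) : Prop where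
  injective : Module.Injective R I
  injective_map : Function.Injective f
  essential : ∀ N : Submodule R I, N ⊓ LinearMap.range f = ⊥ → N = ⊥

/-- A retract of an injective module is injective. -/
theorem injective_of_retract {I J : Type u} [AddCommGroup I] [Module R I] [AddCommGroup J]
    [Module R J] (i : J →ₗ[R] I) (p : I →ₗ[R] J) (hpi : ∀ x, p (i x) = x)
    (hI : Module.Injective R I) : Module.Injective R J where
  out X Y _ _ _ _ f hf g := by
    obtain ⟨h, hh⟩ := hI.out f hf (i ∘ₗ g)
    exact ⟨p ∘ₗ h, fun x => by simp [hh, hpi]⟩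

end Covers

/-! ### Finite dimensional modules -/

/-- A finite dimensional (left) module over the `K`-algebra `R`. Right `A`-modules are modules
over `Aᵐᵒᵖ`. -/
structure FDMod (K : Type u) (R : Type u) [Field K] [Ring R] [Algebra K R] where
  /-- the underlying type -/
  carrier : Type u
  [addCommGroup : AddCommGroup carrier]
  [moduleK : Module K carrier]
  [module : Module R carrier]
  [isScalarTower : IsScalarTower K R carrier]
  [finite : FiniteDimensional K carrier]

namespace FDMod

attribute [instance] FDMod.addCommGroup FDMod.moduleK FDMod.module FDMod.isScalarTower
  FDMod.finite

instance (K : Type u) (R : Type u) [Field K] [Ring R] [Algebra K R] :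
    CoeSort (FDMod K R) (Type u) := ⟨FDMod.carrier⟩

/-- Bundling a finite dimensional module. -/
abbrev of (K : Type u) (R : Type u) [Field K] [Ring R] [Algebra K R] (M : Type u)
    [AddCommGroup M] [Module K M] [Module R M] [IsScalarTower K R M] [FiniteDimensional K M] :
    FDMod K R := ⟨M⟩

instance finiteDimensional_submodule {K : Type u} {R : Type u} [Field K] [Ring R] [Algebra K R]
    {M : Type u} [AddCommGroup M] [Module K M] [Module R M] [IsScalarTower K R M]
    [FiniteDimensional K M] (N : Submodule R M) : FiniteDimensional K N :=
  inferInstanceAs (FiniteDimensional K (N.restrictScalars K))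

/-- The coinduced module `Hom_K(R, M)`, with `(r f)(s) = f(s r)`. -/
def Coind (K R M : Type u) [Field K] [Ring R] [Algebra K R] [AddCommGroup M] [Module K M] :
    Type u := R →ₗ[K] M

namespace Coind

variable (K R M : Type u) [Field K] [Ring R] [Algebra K R] [AddCommGroup M] [Module K M]

instance : AddCommGroup (Coind K R M) := inferInstanceAs (AddCommGroup (R →ₗ[K] M))

instance : Module K (Coind K R M) := inferInstanceAs (Module K (R →ₗ[K] M))

instance [FiniteDimensional K R] [FiniteDimensional K M] : FiniteDimensional K (Coind K R M) :=
  inferInstanceAs (FiniteDimensional K (R →ₗ[K] M))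

variable {K R M} in
/-- Evaluation of an element of the coinduced module. -/
def eval (f : Coind K R M) (s : R) : M := (show R →ₗ[K] M from f) s

instance : Module R (Coind K R M) where
  smul r f := (show R →ₗ[K] M from f) ∘ₗ LinearMap.mulRight K r
  one_smul f := LinearMap.ext fun s => congrArg f.eval (mul_one s)
  mul_smul r s f := LinearMap.ext fun t => congrArg f.eval (mul_assoc t r s).symm
  smul_zero _ := rfl
  smul_add _ _ _ := rfl
  add_smul r s f := LinearMap.ext fun t =>
    (congrArg f.eval (mul_add t r s)).trans (map_add (show R →ₗ[K] M from f) _ _)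
  zero_smul f := LinearMap.ext fun t =>
    (congrArg f.eval (mul_zero t)).trans (map_zero (show R →ₗ[K] M from f))

variable {K R M} in
theorem smul_eval (r : R) (f : Coind K R M) (s : R) : (r • f).eval s = f.eval (s * r) := rfl

instance : IsScalarTower K R (Coind K R M) := ⟨fun k r f => LinearMap.ext fun s =>
  (congrArg f.eval (mul_smul_comm k s r)).trans (map_smul (show R →ₗ[K] M from f) k _)⟩

/-- The embedding `M → Hom_K(R, M)` of an `R`-module `M`. -/
def unit [Module R M] [IsScalarTower K R M] : M →ₗ[R] Coind K R M where
  toFun m := ((LinearMap.toSpanSingleton R M m).restrictScalars K : R →ₗ[K] M)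
  map_add' x y := LinearMap.ext fun s => smul_add s x y
  map_smul' r x := LinearMap.ext fun s => (mul_smul s r x).symm

theorem unit_injective [Module R M] [IsScalarTower K R M] :
    Function.Injective (unit K R M) := fun x y h => by
  have h1 : (1 : R) • x = (1 : R) • y := congrArg (fun f : Coind K R M => f.eval 1) h
  simpa using h1

end Coind

section Resolutions

variable {K : Type u} {R : Type u} [Field K] [Ring R] [Algebra K R] [FiniteDimensional K R]

/-- Every finite dimensional module has a finite dimensional projective cover. -/
theorem exists_projectiveCover (M : FDMod K R) :
    ∃ (P : FDMod K R) (f : P →ₗ[R] M), IsProjectiveCover f := by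
  classical
  have hex : ∃ n : ℕ, ∃ (P : FDMod K R) (f : P →ₗ[R] M), Module.Projective R P ∧
      Function.Surjective f ∧ Module.finrank K P = n := by
    have : Module.Finite R M := Module.Finite.of_restrictScalars_finite K R M
    obtain ⟨k, f, hf⟩ := Module.Finite.exists_fin' R M
    exact ⟨_, of K R (Fin k → R), f, inferInstanceAs (Module.Projective R (Fin k → R)), hf, rfl⟩
  obtain ⟨P, f, hP, hf, hn⟩ := Nat.find_spec hex
  refine ⟨P, f, hP, hf, fun N hN => ?_⟩
  have hs : Function.Surjective (f ∘ₗ N.subtype) := by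
    intro m
    obtain ⟨p, rfl⟩ := hf m
    obtain ⟨x, hx, y, hy, rfl⟩ := Submodule.mem_sup.1 (hN ▸ Submodule.mem_top : p ∈ N ⊔ _)
    exact ⟨⟨x, hx⟩, by simp [LinearMap.mem_ker.1 hy]⟩
  obtain ⟨g₀, hg₀⟩ := Module.projective_lifting_property (f ∘ₗ N.subtype) f hs
  set g : P →ₗ[R] P := N.subtype ∘ₗ g₀ with hg
  have hfg : ∀ n x, f ((g ^ n) x) = f x := by
    intro n
    induction n with
    | zero => simp
    | succ n ih =>
      intro x
      rw [pow_succ, Module.End.mul_apply, ih]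
      exact LinearMap.congr_fun hg₀ x
  have : IsNoetherian R P := isNoetherian_of_tower K inferInstance
  have : IsArtinian R P := isArtinian_of_tower K inferInstance
  obtain ⟨n, hn1, hc⟩ := ((Filter.eventually_ge_atTop 1).and
    (LinearMap.eventually_isCompl_ker_pow_range_pow g)).exists
  set Q : Submodule R P := LinearMap.range (g ^ n)
  have hQ : Module.Projective R Q := by
    refine Module.Projective.of_split Q.subtype (Submodule.projectionOnto Q _ hc.symm) ?_
    ext x
    simp
  have hle := Nat.find_min' hex ⟨of K R Q, f ∘ₗ Q.subtype, hQ, fun m => by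
    obtain ⟨p, rfl⟩ := hf m
    exact ⟨⟨(g ^ n) p, p, rfl⟩, hfg n p⟩, rfl⟩
  rw [← hn] at hle
  have htop : Q.restrictScalars K = ⊤ :=
    Submodule.eq_top_of_finrank_eq (le_antisymm (Submodule.finrank_le _) hle)
  have hQtop : Q = ⊤ := by simpa using htop
  refine top_le_iff.1 (hQtop ▸ ?_)
  rintro _ ⟨x, rfl⟩
  obtain ⟨k, rfl⟩ : ∃ k, n = k + 1 := ⟨n - 1, by omega⟩
  rw [pow_succ', Module.End.mul_apply]
  exact (g₀ _).2

/-- Every finite dimensional module embeds into a finite dimensional injective module. -/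
theorem exists_injective (M : FDMod K R) :
    ∃ (I : FDMod K R) (f : M →ₗ[R] I), Module.Injective R I ∧ Function.Injective f := by
  refine ⟨{ carrier := Coind K R M }, Coind.unit K R M, ⟨fun X Y _ _ _ _ f hf g => ?_⟩,
    Coind.unit_injective K R M⟩
  let _ : Module K X := Module.compHom X (algebraMap K R)
  let _ : Module K Y := Module.compHom Y (algebraMap K R)
  have : IsScalarTower K R X := ⟨fun k r x => by
    change (k • r) • x = algebraMap K R k • r • x
    rw [Algebra.smul_def, mul_smul]⟩
  have : IsScalarTower K R Y := ⟨fun k r x => by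
    change (k • r) • x = algebraMap K R k • r • x
    rw [Algebra.smul_def, mul_smul]⟩
  obtain ⟨q, hq⟩ := (f.restrictScalars K).exists_leftInverse_of_injective
    (LinearMap.ker_eq_bot.2 hf)
  have hq' : ∀ x, q (f x) = x := fun x => LinearMap.congr_fun hq x
  change X →ₗ[R] Coind K R M at g
  let ev : X →ₗ[K] M :=
    { toFun := fun x => (g x).eval 1
      map_add' := fun x y => by rw [map_add]; rfl
      map_smul' := fun k x => by
        rw [← algebraMap_smul R k x, map_smul, Coind.smul_eval, one_mul,
          Algebra.algebraMap_eq_smul_one, Coind.eval, map_smul]; rfl }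
  refine ⟨({ toFun := fun y => (ev ∘ₗ q ∘ₗ
                (LinearMap.toSpanSingleton R Y y).restrictScalars K : R →ₗ[K] M)
             map_add' := fun x y => LinearMap.ext fun s => by
               simp only [LinearMap.comp_apply, LinearMap.coe_restrictScalars,
                 LinearMap.toSpanSingleton_apply, smul_add, map_add]; rfl
             map_smul' := fun r x => LinearMap.ext fun s =>
               congrArg (fun y => ev (q y)) (mul_smul s r x).symm } :
               Y →ₗ[R] Coind K R M), fun x => ?_⟩
  refine LinearMap.ext fun s => ?_
  change (g (q (s • f x))).eval 1 = (g x).eval s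
  rw [← map_smul, hq', map_smul, Coind.smul_eval, one_mul]

/-- Every finite dimensional module has a finite dimensional injective hull. -/
theorem exists_injectiveHull (M : FDMod K R) :
    ∃ (I : FDMod K R) (f : M →ₗ[R] I), IsInjectiveHull f := by
  classical
  have hex : ∃ n : ℕ, ∃ (I : FDMod K R) (f : M →ₗ[R] I), Module.Injective R I ∧
      Function.Injective f ∧ Module.finrank K I = n := by
    obtain ⟨I, f, hI, hf⟩ := exists_injective M
    exact ⟨_, I, f, hI, hf, rfl⟩
  obtain ⟨I, f, hI, hf, hn⟩ := Nat.find_spec hex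
  refine ⟨I, f, hI, hf, fun N hN => ?_⟩
  have hs : Function.Injective (N.mkQ ∘ₗ f) := by
    rw [injective_iff_map_eq_zero]
    intro m hm
    have h1 : f m ∈ N ⊓ LinearMap.range f := ⟨(Submodule.Quotient.mk_eq_zero N).1 hm, m, rfl⟩
    rw [hN, Submodule.mem_bot] at h1
    exact (injective_iff_map_eq_zero f).1 hf m h1
  obtain ⟨h, hh⟩ := hI.out (N.mkQ ∘ₗ f) hs f
  set g : I →ₗ[R] I := h ∘ₗ N.mkQ with hg
  have hfg : ∀ n x, (g ^ n) (f x) = f x := by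
    intro n
    induction n with
    | zero => simp
    | succ n ih =>
      intro x
      rw [pow_succ, Module.End.mul_apply]
      exact (congrArg _ (hh x)).trans (ih x)
  have : IsNoetherian R I := isNoetherian_of_tower K inferInstance
  have : IsArtinian R I := isArtinian_of_tower K inferInstance
  obtain ⟨n, hn1, hc⟩ := ((Filter.eventually_ge_atTop 1).and
    (LinearMap.eventually_isCompl_ker_pow_range_pow g)).exists
  set Q : Submodule R I := LinearMap.range (g ^ n)
  have hQ : Module.Injective R Q :=
    injective_of_retract Q.subtype (Submodule.projectionOnto Q _ hc.symm) (by simp) hI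
  have hle := Nat.find_min' hex ⟨of K R Q, f.codRestrict Q fun m => ⟨f m, hfg n m⟩, hQ,
    fun x y hxy => hf (congrArg Subtype.val hxy), rfl⟩
  rw [← hn] at hle
  have htop : Q.restrictScalars K = ⊤ :=
    Submodule.eq_top_of_finrank_eq (le_antisymm (Submodule.finrank_le _) hle)
  have hQtop : Q = ⊤ := by simpa using htop
  have hker : LinearMap.ker (g ^ n) = ⊥ := by
    have := hc.inf_eq_bot
    rwa [hQtop, inf_top_eq] at this
  refine le_bot_iff.1 (hker ▸ ?_)
  intro x hx
  obtain ⟨k, rfl⟩ : ∃ k, n = k + 1 := ⟨n - 1, by omega⟩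
  rw [LinearMap.mem_ker, pow_succ, Module.End.mul_apply]
  have : g x = 0 := by simp [hg, (Submodule.Quotient.mk_eq_zero N).2 hx]
  rw [this, map_zero]

/-- The projective cover of `M`. -/
noncomputable def projCover (M : FDMod K R) : FDMod K R := M.exists_projectiveCover.choose

/-- The covering map of the projective cover of `M`. -/
noncomputable def projCoverMap (M : FDMod K R) : M.projCover →ₗ[R] M :=
  M.exists_projectiveCover.choose_spec.choose

theorem isProjectiveCover_projCoverMap (M : FDMod K R) : IsProjectiveCover M.projCoverMap :=
  M.exists_projectiveCover.choose_spec.choose_spec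

/-- The injective hull of `M`. -/
noncomputable def injHull (M : FDMod K R) : FDMod K R := M.exists_injectiveHull.choose

/-- The embedding of `M` into its injective hull. -/
noncomputable def injHullMap (M : FDMod K R) : M →ₗ[R] M.injHull :=
  M.exists_injectiveHull.choose_spec.choose

theorem isInjectiveHull_injHullMap (M : FDMod K R) : IsInjectiveHull M.injHullMap :=
  M.exists_injectiveHull.choose_spec.choose_spec

/-- The syzygy `Ω(M)`: the kernel of the projective cover. -/
noncomputable def syzygy (M : FDMod K R) : FDMod K R :=
  of K R (LinearMap.ker M.projCoverMap)

/-- The cosyzygy `Ω⁻¹(M)`: the cokernel of the injective hull. -/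
noncomputable def cosyzygy (M : FDMod K R) : FDMod K R :=
  of K R (M.injHull ⧸ LinearMap.range M.injHullMap)

/-- The `i`-th term `Iᵢ` of the minimal injective resolution `0 → M → I₀ → I₁ → ⋯`, which is the
injective hull of `Ω⁻ⁱ(M)`. -/
noncomputable def injResolution (M : FDMod K R) (i : ℕ) : FDMod K R :=
  (cosyzygy^[i] M).injHull

/-- The dominant dimension: the supremum of all `n` such that `I₀, …, Iₙ₋₁` are projective. -/
noncomputable def domDim (M : FDMod K R) : ℕ∞ :=
  ⨆ n : {n : ℕ // ∀ i < n, Module.Projective R (M.injResolution i)}, (n : ℕ∞)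

/-- The map `P₁ → P₀` of the minimal projective presentation `P₁ → P₀ → M → 0`, where `P₀` is the
projective cover of `M` and `P₁` is the projective cover of `Ω(M)`. -/
noncomputable def presentationMap (M : FDMod K R) : M.syzygy.projCover →ₗ[R] M.projCover :=
  (LinearMap.ker M.projCoverMap).subtype ∘ₗ M.syzygy.projCoverMap

end Resolutions

/-! ### Duality, transpose and the Auslander-Reiten translates -/

section Duality

variable {K : Type u} {A : Type u} [Field K] [Ring A] [Algebra K A]

/-- The `K`-dual `D(M)` of a left `A`-module `M` is a right `A`-module by `(f a)(m) = f(a m)`. -/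
def dualOfLeft (M : FDMod K A) : FDMod K Aᵐᵒᵖ where
  carrier := M →ₗ[K] K
  module :=
    { smul := fun a f => f ∘ₗ Module.toModuleEnd K M (unop a)
      one_smul := fun f => LinearMap.ext fun m => congrArg f (one_smul A m)
      mul_smul := fun a b f => LinearMap.ext fun m => congrArg f (mul_smul (unop b) (unop a) m)
      smul_zero := fun _ => rfl
      smul_add := fun _ _ _ => rfl
      add_smul := fun a b f => LinearMap.ext fun m =>
        (congrArg f (add_smul (unop a) (unop b) m)).trans (map_add f _ _)
      zero_smul := fun f => LinearMap.ext fun m =>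
        (congrArg f (zero_smul A m)).trans (map_zero f) }
  isScalarTower := @IsScalarTower.mk _ _ _ _ (_) _ fun k a f => LinearMap.ext fun m =>
    (congrArg f (smul_assoc k (unop a) m)).trans (map_smul f k _)

/-- The `K`-dual `D(M)` of a right `A`-module `M` is a left `A`-module by `(a f)(m) = f(m a)`. -/
def dualOfRight (M : FDMod K Aᵐᵒᵖ) : FDMod K A where
  carrier := M →ₗ[K] K
  module :=
    { smul := fun a f => f ∘ₗ Module.toModuleEnd K M (op a)
      one_smul := fun f => LinearMap.ext fun m => congrArg f (one_smul Aᵐᵒᵖ m)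
      mul_smul := fun a b f => LinearMap.ext fun m => congrArg f (mul_smul (op b) (op a) m)
      smul_zero := fun _ => rfl
      smul_add := fun _ _ _ => rfl
      add_smul := fun a b f => LinearMap.ext fun m =>
        (congrArg f (add_smul (op a) (op b) m)).trans (map_add f _ _)
      zero_smul := fun f => LinearMap.ext fun m =>
        (congrArg f (zero_smul Aᵐᵒᵖ m)).trans (map_zero f) }
  isScalarTower := @IsScalarTower.mk _ _ _ _ (_) _ fun k a f => LinearMap.ext fun m =>
    (congrArg f (smul_assoc k (op a) m)).trans (map_smul f k _)

theorem dualOfLeft_smul_apply (M : FDMod K A) (a : A) (f : M.dualOfLeft) (m : M) :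
    (show M →ₗ[K] K from op a • f) m = (show M →ₗ[K] K from f) (a • m) := rfl

theorem dualOfRight_smul_apply (M : FDMod K Aᵐᵒᵖ) (a : A) (f : M.dualOfRight) (m : M) :
    (show M →ₗ[K] K from a • f) m = (show M →ₗ[K] K from f) (op a • m) := rfl

variable [FiniteDimensional K A]

theorem finite_hom_of_left (P : FDMod K A) : FiniteDimensional K (P →ₗ[A] A) :=
  Module.Finite.of_injective (LinearMap.restrictScalarsₗ K A P A K)
    (LinearMap.restrictScalars_injective K)

theorem finite_hom_of_right (P : FDMod K Aᵐᵒᵖ) : FiniteDimensional K (P →ₗ[Aᵐᵒᵖ] A) :=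
  Module.Finite.of_injective (LinearMap.restrictScalarsₗ K Aᵐᵒᵖ P A K)
    (LinearMap.restrictScalars_injective K)

/-- The transpose `Tr(M)` of a left `A`-module: the cokernel of the right `A`-linear map
`Hom_A(P₀, A) → Hom_A(P₁, A)` induced by the minimal projective presentation `P₁ → P₀ → M → 0`. -/
noncomputable def transposeOfLeft (M : FDMod K A) : FDMod K Aᵐᵒᵖ :=
  haveI := finite_hom_of_left M.syzygy.projCover
  of K Aᵐᵒᵖ ((M.syzygy.projCover →ₗ[A] A) ⧸
    LinearMap.range (LinearMap.lcomp Aᵐᵒᵖ A M.presentationMap))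

/-- The transpose `Tr(M)` of a right `A`-module: the cokernel of the left `A`-linear map
`Hom_A(P₀, A) → Hom_A(P₁, A)` induced by the minimal projective presentation `P₁ → P₀ → M → 0`. -/
noncomputable def transposeOfRight (M : FDMod K Aᵐᵒᵖ) : FDMod K A :=
  haveI := finite_hom_of_right M.syzygy.projCover
  of K A ((M.syzygy.projCover →ₗ[Aᵐᵒᵖ] A) ⧸
    LinearMap.range (LinearMap.lcomp A A M.presentationMap))

/-- The Auslander-Reiten translate `τ = D Tr` of a right `A`-module. -/
noncomputable def tau (M : FDMod K Aᵐᵒᵖ) : FDMod K Aᵐᵒᵖ := M.transposeOfRight.dualOfLeft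

/-- The inverse Auslander-Reiten translate `τ⁻¹ = Tr D` of a right `A`-module. -/
noncomputable def tauInv (M : FDMod K Aᵐᵒᵖ) : FDMod K Aᵐᵒᵖ := M.dualOfRight.transposeOfLeft

/-- The codominant dimension of a right `A`-module `M`: the dominant dimension of `D(M)`. -/
noncomputable def codomDim (M : FDMod K Aᵐᵒᵖ) : ℕ∞ := M.dualOfRight.domDim

end Duality

end FDMod

/-! ### Gendo-symmetric algebras -/

section Algebras

variable (K : Type u) {A : Type u} [Field K] [Ring A] [Algebra K A] [FiniteDimensional K A]

/-- The left ideal `Ae`. -/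
abbrev leftIdeal (e : A) : Submodule A A := LinearMap.range (LinearMap.toSpanSingleton A A e)

/-- The right ideal `eA`. -/
abbrev rightIdeal (e : A) : Submodule Aᵐᵒᵖ A :=
  LinearMap.range (LinearMap.toSpanSingleton Aᵐᵒᵖ A e)

/-- Right multiplication by the element `ece` of `eAe` on `Ae`. -/
def mulRightCorner (e c : A) : leftIdeal e →ₗ[K] leftIdeal e where
  toFun x := ⟨(x : A) * (e * c * e), (x : A) * (e * c), by simp [mul_assoc]⟩
  map_add' x y := Subtype.ext (by simp [add_mul])
  map_smul' k x := Subtype.ext (by simp)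

/-- `eA` (with `e` idempotent) is a minimal faithful projective-injective right `A`-module:
it is projective, injective and faithful, and it is a direct summand of every finite dimensional
faithful right `A`-module. -/
structure IsMinimalFaithfulProjInj (e : A) : Prop where
  idempotent : IsIdempotentElem e
  projective : Module.Projective Aᵐᵒᵖ (rightIdeal e)
  injective : Module.Injective Aᵐᵒᵖ (rightIdeal e)
  faithful : FaithfulSMul Aᵐᵒᵖ (rightIdeal e)
  minimal : ∀ X : FDMod K Aᵐᵒᵖ, FaithfulSMul Aᵐᵒᵖ X →
    ∃ (i : rightIdeal e →ₗ[Aᵐᵒᵖ] X) (p : X →ₗ[Aᵐᵒᵖ] rightIdeal e), p ∘ₗ i = LinearMap.id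

/-- `D(Ae) ≅ eA` as `(eAe, A)`-bimodules, where `b ∈ eAe` acts on `D(Ae)` by
`(b f)(x) = f(x b)`. -/
def DualIsoAsBimodule (e : A) : Prop :=
  ∃ φ : (FDMod.of K A (leftIdeal e)).dualOfLeft ≃ₗ[Aᵐᵒᵖ] rightIdeal e,
    ∀ (c : A) (f : leftIdeal e →ₗ[K] K),
      (φ (f ∘ₗ mulRightCorner K e c : leftIdeal e →ₗ[K] K) : A) = (e * c * e) * (φ f : A)

variable (A) in
/-- A gendo-symmetric algebra: the dominant dimension of `A` is at least `2` and
`D(Ae) ≅ eA` as `(eAe, A)`-bimodules, where `eA` is the minimal faithful projective-injective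
right `A`-module. -/
structure IsGendoSymmetric : Prop where
  two_le_domDim : 2 ≤ (FDMod.of K Aᵐᵒᵖ A).domDim
  exists_idempotent : ∃ e : A, IsMinimalFaithfulProjInj K e ∧ DualIsoAsBimodule K e

end Algebras

end GendoSymm

/-!
Let `e` be the idempotent of a gendo-symmetric algebra `A`. The image of `e` under the bimodule
isomorphism `D(Ae) ≅ eA` is a symmetrizing form on `eAe`, and it identifies the Nakayama functor
`ν = D Hom(-, A)` with the identity on `add eA`. Let `P₁ → P₀ → M → 0` be a minimal projective
presentation. Then `τ M` is the kernel of `ν P₁ → ν P₀` and `Ω² M` is the kernel of `P₁ → P₀`.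
Moreover `codomdim M ≥ 2` means that `P₀` and `P₁` are injective, that is, in `add eA`, and in this
case the two kernels agree.

Conversely, a second syzygy is copresented by `eA`, since `A` is. If `τ M` is cogenerated by `eA`,
minimality puts `P₁` into `add eA`. If `τ M` is even copresented by `eA`, then each map `P₀ → A`
factors through `P₀ → M` up to maps with values in the trace of `eA`. Hence the part of `P₀` outside
`add eA` is a summand of `M`, and it vanishes when the projective summands of `M` are injective.

The second statement is the first one for `D(M)` over the opposite algebra. The condition on `e` is
self-dual, and the double centralizer property passes to the other side by adjunction with respect
to the trace form.
-/

namespace GendoSymm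

open MulOpposite

theorem exists_apply_eq_of_separating {K V W : Type*} [Field K] [AddCommGroup V] [Module K V]
    [AddCommGroup W] [Module K W] [FiniteDimensional K W] (B : V →ₗ[K] W →ₗ[K] K)
    (l : W →ₗ[K] K) (h : ∀ w, (∀ v, B v w = 0) → l w = 0) : ∃ v, B v = l := by
  suffices hl : l ∈ (LinearMap.range B).dualCoannihilator.dualAnnihilator by
    rwa [Subspace.dualCoannihilator_dualAnnihilator_eq] at hl
  refine (Submodule.mem_dualAnnihilator l).2 fun w hw => h w fun v => ?_
  exact (Submodule.mem_dualCoannihilator w).1 hw _ ⟨v, rfl⟩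

theorem exists_functional_of_notMem {K R M : Type*} [Field K] [Ring R] [Algebra K R]
    [AddCommGroup M] [Module K M] [Module R M] [IsScalarTower K R M] (N : Submodule R M) {x : M}
    (hx : x ∉ N) : ∃ l : M →ₗ[K] K, l x ≠ 0 ∧ ∀ n ∈ N, l n = 0 := by
  obtain ⟨l, hl, hN⟩ := Submodule.exists_le_ker_of_notMem (p := N.restrictScalars K) (v := x)
    (by simpa only [Submodule.restrictScalars_mem] using hx)
  exact ⟨l, hl, fun n hn => hN hn⟩

/-! ### Summands of sums of copies of `Re` -/

section Corner

variable {R : Type*} [Ring R]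

/-- The submodule `ReX` of `X`, which is the trace of `Re` in `X` when `e` is idempotent. -/
def traceSub (e : R) (X : Type*) [AddCommGroup X] [Module R X] : Submodule R X :=
  Submodule.span R (Set.range fun x : X => e • x)

section TraceSub

variable {e : R} {X Y : Type*} [AddCommGroup X] [Module R X] [AddCommGroup Y] [Module R Y]

variable (e) in
theorem smul_mem_traceSub (x : X) : e • x ∈ traceSub e X :=
  Submodule.subset_span ⟨x, rfl⟩

theorem traceSub_le {N : Submodule R X} (h : ∀ x, e • x ∈ N) : traceSub e X ≤ N :=
  Submodule.span_le.2 (Set.range_subset_iff.2 h)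

theorem map_mem_traceSub (f : X →ₗ[R] Y) {x : X} (hx : x ∈ traceSub e X) :
    f x ∈ traceSub e Y := by
  refine traceSub_le (N := (traceSub e Y).comap f) (fun z => ?_) hx
  rw [Submodule.mem_comap, map_smul]
  exact smul_mem_traceSub e _

theorem traceSub_eq_top_of_surjective (f : X →ₗ[R] Y) (hf : Function.Surjective f)
    (hX : traceSub e X = ⊤) : traceSub e Y = ⊤ := by
  refine Submodule.eq_top_iff'.2 fun y => ?_
  obtain ⟨x, rfl⟩ := hf y
  exact map_mem_traceSub f (hX ▸ Submodule.mem_top)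

variable (e X) in
theorem traceSub_quotient : traceSub e (X ⧸ traceSub e X) = ⊥ := by
  refine eq_bot_iff.2 (traceSub_le fun y => ?_)
  obtain ⟨x, rfl⟩ := Submodule.mkQ_surjective _ y
  rw [← map_smul, Submodule.mem_bot, Submodule.mkQ_apply, Submodule.Quotient.mk_eq_zero]
  exact smul_mem_traceSub e x

end TraceSub

/-- A dual basis exhibiting `P` as a direct summand of `(Re)ⁿ`: the vectors lie in `eP` and the
coordinate functions take values in `Re`. For `e = 1` this is a dual basis of a finitely generated
projective module. -/
structure CornerBasis (e : R) (P : Type*) [AddCommGroup P] [Module R P] where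
  /-- the number of copies of `Re` -/
  card : ℕ
  /-- the vectors -/
  vec : Fin card → P
  /-- the coordinate functions -/
  coord : Fin card → P →ₗ[R] R
  smul_vec : ∀ i, e • vec i = vec i
  coord_mul : ∀ i x, coord i x * e = coord i x
  sum_coord_smul : ∀ x, ∑ i, coord i x • vec i = x

namespace CornerBasis

variable {e : R} {P : Type*} [AddCommGroup P] [Module R P]

theorem projective (b : CornerBasis e P) : Module.Projective R P :=
  Module.Projective.of_split (LinearMap.pi b.coord) (Fintype.linearCombination R b.vec) <|
    LinearMap.ext fun x => by
      simp only [LinearMap.comp_apply, Fintype.linearCombination_apply, LinearMap.pi_apply,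
        b.sum_coord_smul, LinearMap.id_apply]

theorem traceSub_eq_top (b : CornerBasis e P) : traceSub e P = ⊤ := by
  refine Submodule.eq_top_iff'.2 fun x => b.sum_coord_smul x ▸ Submodule.sum_mem _ fun i _ => ?_
  rw [← b.smul_vec i]
  exact Submodule.smul_mem _ _ (smul_mem_traceSub e _)

theorem map_eq_sum {Q : Type*} [AddCommGroup Q] [Module R Q] (b : CornerBasis e P)
    (f : P →ₗ[R] Q) (x : P) : f x = ∑ i, b.coord i x • f (b.vec i) := by
  conv_lhs => rw [← b.sum_coord_smul x]
  simp only [map_sum, map_smul]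

/-- The dual `Hom_R(P, R)` of a summand of `(Re)ⁿ` is a summand of `(eR)ⁿ`; here right modules are
modules over the opposite ring. -/
def dual (b : CornerBasis e P) : CornerBasis (op e) (P →ₗ[R] R) where
  card := b.card
  vec := b.coord
  coord i :=
    { toFun := fun f => op (f (b.vec i))
      map_add' := fun _ _ => rfl
      map_smul' := fun _ _ => rfl }
  smul_vec i := LinearMap.ext (b.coord_mul i)
  coord_mul i f := congrArg op <| (map_smul f e (b.vec i)).symm.trans (congrArg f (b.smul_vec i))
  sum_coord_smul f := LinearMap.ext fun x => by
    rw [b.map_eq_sum f x, LinearMap.sum_apply]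
    rfl

theorem nonempty_of_span_eq_top (he : IsIdempotentElem e) [Module.Projective R P]
    {s : Finset P} (hs : ∀ x ∈ s, e • x = x) (hspan : Submodule.span R (s : Set P) = ⊤) :
    Nonempty (CornerBasis e P) := by
  let v : Fin s.card → P := fun i => s.equivFin.symm i
  have hv (i) : e • v i = v i := hs _ (s.equivFin.symm i).2
  have hsurj : Function.Surjective (Fintype.linearCombination R v) := by
    rw [← LinearMap.range_eq_top, Fintype.range_linearCombination, ← hspan]
    exact congrArg _ ((s.equivFin.symm.surjective.range_comp Subtype.val).trans Subtype.range_val)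
  obtain ⟨g, hg⟩ := Module.projective_lifting_property _ LinearMap.id hsurj
  refine ⟨⟨s.card, v, fun i => LinearMap.toSpanSingleton R R e ∘ₗ LinearMap.proj i ∘ₗ g, hv,
    fun i x => ?_, fun x => ?_⟩⟩
  · simp only [LinearMap.comp_apply, LinearMap.toSpanSingleton_apply, smul_eq_mul, mul_assoc,
      he.eq]
  · simpa only [LinearMap.comp_apply, LinearMap.toSpanSingleton_apply, smul_eq_mul, mul_smul, hv,
      LinearMap.proj_apply, Fintype.linearCombination_apply, LinearMap.id_apply]
      using LinearMap.congr_fun hg x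

variable (R P) in
theorem nonempty_one [Module.Projective R P] [hP : Module.Finite R P] :
    Nonempty (CornerBasis (1 : R) P) :=
  let ⟨_, hs⟩ := hP.fg_top
  nonempty_of_span_eq_top .one (fun x _ => one_smul R x) hs

theorem nonempty_of_traceSub_eq_top (he : IsIdempotentElem e) [Module.Projective R P]
    [hfin : Module.Finite R P] (hP : traceSub e P = ⊤) : Nonempty (CornerBasis e P) := by
  have hfg : (traceSub e P).FG := hP.symm ▸ hfin.fg_top
  obtain ⟨s, hs, hspan⟩ := (Submodule.fg_span_iff_fg_span_finset_subset _).1 hfg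
  refine nonempty_of_span_eq_top he (fun x hx => ?_) (hspan.symm.trans hP)
  obtain ⟨y, rfl⟩ := hs hx
  exact (smul_smul e e y).trans (congrArg (· • y) he)

end CornerBasis

end Corner

/-! ### Symmetric idempotents -/

/-- An idempotent `e` with a linear form `t` on `eRe` (extended to `R` by zero) which makes `eRe`
symmetric, such that the pairing `eR × Re → K`, `(x, y) ↦ t (x y)` is perfect and
`R` acts faithfully on `eR`. -/
structure IsSymmetricIdempotent (K : Type*) {R : Type*} [Field K] [Ring R] [Algebra K R] (e : R)
    (t : R →ₗ[K] K) : Prop where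
  idem : IsIdempotentElem e
  left : ∀ a, t (e * a) = t a
  right : ∀ a, t (a * e) = t a
  symm : ∀ a b, t (a * e * b) = t (b * e * a)
  nondeg_left : ∀ x, (∀ y, t (x * y) = 0) → e * x = 0
  nondeg_right : ∀ y, (∀ x, t (x * y) = 0) → y * e = 0
  faithful : ∀ a, (∀ x, e * x * a = 0) → a = 0

namespace IsSymmetricIdempotent

variable {K R : Type*} [Field K] [Ring R] [Algebra K R] {e : R} {t : R →ₗ[K] K}

theorem ext_right (H : IsSymmetricIdempotent K e t) {y z : R} (hy : y * e = y) (hz : z * e = z)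
    (h : ∀ x, t (x * y) = t (x * z)) : y = z := by
  have := H.nondeg_right (y - z) fun x => by rw [mul_sub, map_sub, h, sub_self]
  rwa [sub_mul, hy, hz, sub_eq_zero] at this

theorem ext_left (H : IsSymmetricIdempotent K e t) {x z : R} (hx : e * x = x) (hz : e * z = z)
    (h : ∀ y, t (x * y) = t (z * y)) : x = z := by
  have := H.nondeg_left (x - z) fun y => by rw [sub_mul, map_sub, h, sub_self]
  rwa [mul_sub, hx, hz, sub_eq_zero] at this

theorem eq_zero_of_mul_mul_eq_zero (H : IsSymmetricIdempotent K e t) {a : R}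
    (h : ∀ x, a * x * e = 0) : a = 0 := by
  refine H.faithful a fun x => (mul_assoc e x a).trans (H.nondeg_left (x * a) fun y => ?_)
  rw [← H.right, mul_assoc, mul_assoc, ← mul_assoc a, h, mul_zero, map_zero]

theorem op (H : IsSymmetricIdempotent K e t) :
    IsSymmetricIdempotent K (MulOpposite.op e) (t ∘ₗ (opLinearEquiv K).symm.toLinearMap) where
  idem := congrArg MulOpposite.op H.idem
  left a := H.right a.unop
  right a := H.left a.unop
  symm a b := by
    simpa only [LinearMap.comp_apply, LinearEquiv.coe_coe, coe_opLinearEquiv_symm, unop_mul,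
      unop_op, mul_assoc] using H.symm b.unop a.unop
  nondeg_left x h := unop_injective (H.nondeg_right x.unop fun y => h (MulOpposite.op y))
  nondeg_right x h := unop_injective (H.nondeg_left x.unop fun y => h (MulOpposite.op y))
  faithful a h := unop_injective <| H.eq_zero_of_mul_mul_eq_zero fun x =>
    (mul_assoc _ _ _).trans (congrArg unop (h (MulOpposite.op x)))

section Rep

variable [FiniteDimensional K R]

theorem exists_rep (H : IsSymmetricIdempotent K e t) (l : R →ₗ[K] K) :
    ∃ y, y * e = y ∧ ∀ x, t (x * y) = l (e * x) := by
  obtain ⟨y, hy⟩ := exists_apply_eq_of_separating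
    ((LinearMap.mul K R).compr₂ t).flip (l ∘ₗ LinearMap.mulLeft K e) fun w hw => by
      rw [LinearMap.comp_apply, LinearMap.mulLeft_apply, H.nondeg_left w hw, map_zero]
  refine ⟨y * e, by rw [mul_assoc, H.idem], fun x => ?_⟩
  rw [← mul_assoc, H.right]
  exact LinearMap.congr_fun hy x

/-- The element of `Re` that represents a functional on `eR` via the trace form. -/
noncomputable def rep (H : IsSymmetricIdempotent K e t) (l : R →ₗ[K] K) : R :=
  (H.exists_rep l).choose

theorem rep_mul (H : IsSymmetricIdempotent K e t) (l : R →ₗ[K] K) : H.rep l * e = H.rep l :=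
  (H.exists_rep l).choose_spec.1

theorem trace_mul_rep (H : IsSymmetricIdempotent K e t) (l : R →ₗ[K] K) (x : R) :
    t (x * H.rep l) = l (e * x) :=
  (H.exists_rep l).choose_spec.2 x

variable {X : Type*} [AddCommGroup X] [Module K X] [Module R X] [IsScalarTower K R X]

/-- The `R`-linear map `X → Re` that corresponds to a functional on `eX`, as
`Re ≅ Hom_K(eR, K)`. -/
noncomputable def repMap (H : IsSymmetricIdempotent K e t) (l : X →ₗ[K] K) : X →ₗ[R] R where
  toFun x := H.rep (l ∘ₗ (LinearMap.toSpanSingleton R X x).restrictScalars K)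
  map_add' x y := H.ext_right (H.rep_mul _) (by rw [add_mul, H.rep_mul, H.rep_mul]) fun z => by
    rw [mul_add, map_add]
    simp only [trace_mul_rep, LinearMap.comp_apply, LinearMap.coe_restrictScalars,
      LinearMap.toSpanSingleton_apply, smul_add, map_add]
  map_smul' r x := H.ext_right (H.rep_mul _) (by
      rw [RingHom.id_apply, smul_eq_mul, mul_assoc, H.rep_mul]) fun z => by
    rw [RingHom.id_apply, smul_eq_mul, ← mul_assoc]
    simp only [trace_mul_rep, LinearMap.comp_apply, LinearMap.coe_restrictScalars,
      LinearMap.toSpanSingleton_apply, mul_smul]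

theorem repMap_mul (H : IsSymmetricIdempotent K e t) (l : X →ₗ[K] K) (x : X) :
    H.repMap l x * e = H.repMap l x := H.rep_mul _

theorem trace_mul_repMap (H : IsSymmetricIdempotent K e t) (l : X →ₗ[K] K) (r : R) (x : X) :
    t (r * H.repMap l x) = l ((e * r) • x) := H.trace_mul_rep _ r

end Rep

end IsSymmetricIdempotent

/-! ### Modules that are cogenerated or copresented by `Re` -/

section Closed

variable {R : Type*} [Ring R]

/-- No nonzero element of `X` is annihilated by `eR`. For a symmetric idempotent this means that
`X` is cogenerated by `Re`. -/
def IsTorsionFree (e : R) (X : Type*) [AddCommGroup X] [Module R X] : Prop :=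
  ∀ x : X, (∀ r, (e * r) • x = 0) → x = 0

/-- The canonical map `X → Hom_{eRe}(eR, eX)` is bijective. For a symmetric idempotent this means
that `X` is copresented by `Re`. An `eRe`-linear map `eR → eX` is encoded by its composite with
`R → eR`, `r ↦ e r`. -/
structure IsCornerClosed (K : Type*) [Field K] [Algebra K R] (e : R) (X : Type*) [AddCommGroup X]
    [Module K X] [Module R X] : Prop where
  torsionFree : IsTorsionFree e X
  exists_eq : ∀ f : R →ₗ[K] X, (∀ s r, f (e * s * e * r) = (e * s * e) • f r) →
    ∃ x, ∀ r, f (e * r) = (e * r) • x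

theorem IsTorsionFree.of_injective {e : R} {X Y : Type*} [AddCommGroup X] [Module R X]
    [AddCommGroup Y] [Module R Y] (hY : IsTorsionFree e Y) (f : X →ₗ[R] Y)
    (hf : Function.Injective f) : IsTorsionFree e X := fun x hx =>
  (injective_iff_map_eq_zero f).1 hf x (hY _ fun r => by rw [← map_smul, hx, map_zero])

section Algebra

variable {K : Type*} [Field K] [Algebra K R] {e : R} {t : R →ₗ[K] K}

theorem IsTorsionFree.of_projective (H : IsSymmetricIdempotent K e t) (P : Type*)
    [AddCommGroup P] [Module R P] [Module.Projective R P] [Module.Finite R P] :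
    IsTorsionFree e P := by
  obtain ⟨b⟩ := CornerBasis.nonempty_one R P
  intro x hx
  rw [← b.sum_coord_smul x]
  refine Finset.sum_eq_zero fun i _ => ?_
  rw [H.faithful (b.coord i x) fun r => ?_, zero_smul]
  rw [← smul_eq_mul, ← map_smul, hx, map_zero]

namespace IsCornerClosed

theorem of_coord {P : Type*} [AddCommGroup P] [Module K P] [Module R P] {a : R}
    (b : CornerBasis a P) (hP : IsTorsionFree e P)
    (h : ∀ f : R →ₗ[K] P, (∀ s r, f (e * s * e * r) = (e * s * e) • f r) →
      ∀ i, ∃ y, ∀ r, b.coord i (f (e * r)) = e * r * y) : IsCornerClosed K e P := by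
  refine ⟨hP, fun f hf => ?_⟩
  choose y hy using h f hf
  refine ⟨∑ i, y i • b.vec i, fun r => ?_⟩
  rw [← b.sum_coord_smul (f (e * r)), Finset.smul_sum]
  exact Finset.sum_congr rfl fun i _ => by rw [hy, mul_smul]

theorem of_projective (H : IsSymmetricIdempotent K e t) (hR : IsCornerClosed K e R)
    (P : Type*) [AddCommGroup P] [Module K P] [Module R P] [IsScalarTower K R P]
    [Module.Projective R P] [Module.Finite R P] : IsCornerClosed K e P := by
  obtain ⟨b⟩ := CornerBasis.nonempty_one R P
  refine of_coord b (.of_projective H P) fun f hf i => ?_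
  exact hR.exists_eq ((b.coord i).restrictScalars K ∘ₗ f) fun s r => by
    simp only [LinearMap.comp_apply, hf, LinearMap.coe_restrictScalars, map_smul]

theorem of_exact {X C T : Type*} [AddCommGroup X] [Module K X] [Module R X]
    [IsScalarTower K R X] [AddCommGroup C] [Module K C] [Module R C] [IsScalarTower K R C]
    [AddCommGroup T] [Module R T] (hC : IsCornerClosed K e C) (hT : IsTorsionFree e T)
    {i : X →ₗ[R] C} {d : C →ₗ[R] T} (hi : Function.Injective i) (hd : Function.Exact i d) :
    IsCornerClosed K e X := by
  refine ⟨hC.torsionFree.of_injective i hi, fun f hf => ?_⟩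
  obtain ⟨c, hc⟩ := hC.exists_eq (i.restrictScalars K ∘ₗ f) fun s r => by
    simp only [LinearMap.comp_apply, hf, LinearMap.coe_restrictScalars, map_smul]
  have hdc : d c = 0 := hT _ fun r => by
    rw [← map_smul, ← hc]
    exact hd.apply_apply_eq_zero _
  obtain ⟨x, rfl⟩ := (hd c).1 hdc
  exact ⟨x, fun r => hi (by rw [map_smul, ← hc]; rfl)⟩

theorem of_linearEquiv {X Y : Type*} [AddCommGroup X] [Module K X] [Module R X]
    [IsScalarTower K R X] [AddCommGroup Y] [Module K Y] [Module R Y] [IsScalarTower K R Y]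
    (hX : IsCornerClosed K e X) (f : Y ≃ₗ[R] X) : IsCornerClosed K e Y :=
  hX.of_exact (T := PUnit.{1}) (fun _ _ => rfl) (i := f.toLinearMap) (d := 0) f.injective fun c =>
    ⟨fun _ => f.surjective c, fun _ => rfl⟩

end IsCornerClosed

variable [FiniteDimensional K R]

theorem CornerBasis.isCornerClosed (H : IsSymmetricIdempotent K e t) {P : Type*} [AddCommGroup P]
    [Module K P] [Module R P] [IsScalarTower K R P] [Module.Finite R P] (b : CornerBasis e P) :
    IsCornerClosed K e P := by
  have := b.projective
  refine .of_coord b (.of_projective H P) fun f hf i => ?_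
  have hfe (r : R) : f (e * r) = e • f r := by simpa only [mul_one, H.idem.eq] using hf 1 r
  refine ⟨H.rep (t ∘ₗ (b.coord i).restrictScalars K ∘ₗ f), fun r => ?_⟩
  refine H.ext_right (b.coord_mul i _) (by rw [mul_assoc, H.rep_mul]) fun s => ?_
  calc t (s * b.coord i (f (e * r))) = t (b.coord i (f (e * s * e * r))) := by
        rw [hf, hfe, map_smul, map_smul, smul_eq_mul, smul_eq_mul, ← H.left]
        simp only [mul_assoc]
    _ = t (s * (e * r * H.rep (t ∘ₗ (b.coord i).restrictScalars K ∘ₗ f))) := by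
        rw [← mul_assoc s, H.trace_mul_rep]
        simp only [LinearMap.comp_apply, LinearMap.coe_restrictScalars, mul_assoc]

end Algebra

end Closed

/-! ### Dominant dimension at least two -/

section DomDim

variable {K R : Type u} [Field K] [Ring R] [Algebra K R] [FiniteDimensional K R] {e : R}
  {t : R →ₗ[K] K}

theorem CornerBasis.nonempty_of_injective (H : IsSymmetricIdempotent K e t) {X : Type u}
    [AddCommGroup X] [Module K X] [Module R X] [IsScalarTower K R X] [FiniteDimensional K X]
    (hX : IsTorsionFree e X) (hI : Module.Injective R X) : Nonempty (CornerBasis e X) := by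
  let c := Module.finBasis K X
  let f : X →ₗ[R] (Fin (Module.finrank K X) → R) := LinearMap.pi fun i => H.repMap (c.coord i)
  have hf : Function.Injective f := (injective_iff_map_eq_zero f).2 fun x hx =>
    hX x fun r => c.ext_elem fun i => by
      have hrep := H.trace_mul_repMap (c.coord i) r x
      rw [show H.repMap (c.coord i) x = 0 from congrFun hx i, mul_zero, map_zero] at hrep
      rw [map_zero, Finsupp.zero_apply]
      exact hrep.symm
  obtain ⟨g, hg⟩ := hI.out f hf LinearMap.id
  refine ⟨⟨_, fun i => g (Pi.single i e), fun i => H.repMap (c.coord i), fun i => ?_,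
    fun i x => H.repMap_mul _ x, fun x => ?_⟩⟩
  · rw [← map_smul, ← Pi.single_smul, smul_eq_mul, H.idem]
  · simp only [← map_smul, ← map_sum, ← Pi.single_smul, smul_eq_mul, H.repMap_mul]
    exact (congrArg g (Finset.univ_sum_single (f x))).trans (hg x)

namespace FDMod

theorem two_le_domDim_iff (X : FDMod K R) :
    2 ≤ X.domDim ↔ Module.Projective R X.injHull ∧ Module.Projective R X.cosyzygy.injHull := by
  constructor
  · intro h
    have hlt : (1 : ℕ∞) < X.domDim := lt_of_lt_of_le (by norm_num) h
    obtain ⟨⟨n, hn⟩, hn1⟩ := lt_iSup_iff.1 hlt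
    have hn2 : 1 < n := by exact_mod_cast hn1
    exact ⟨hn 0 (by omega), hn 1 hn2⟩
  · rintro ⟨h₀, h₁⟩
    refine le_iSup (fun n : {n : ℕ // ∀ i < n, Module.Projective R (X.injResolution i)} =>
      ((n : ℕ) : ℕ∞)) ⟨2, fun i hi => ?_⟩
    interval_cases i
    exacts [h₀, h₁]

theorem isCornerClosed_of_two_le_domDim (H : IsSymmetricIdempotent K e t) {X : FDMod K R}
    (hX : 2 ≤ X.domDim) : IsCornerClosed K e X := by
  obtain ⟨h₀, h₁⟩ := X.two_le_domDim_iff.1 hX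
  have : Module.Finite R X.injHull := .of_restrictScalars_finite K R _
  have : Module.Finite R X.cosyzygy.injHull := .of_restrictScalars_finite K R _
  have hI := X.isInjectiveHull_injHullMap
  have hI' := X.cosyzygy.isInjectiveHull_injHullMap
  obtain ⟨b⟩ := CornerBasis.nonempty_of_injective H (.of_projective H X.injHull) hI.injective
  refine (b.isCornerClosed H).of_exact (.of_projective H X.cosyzygy.injHull) hI.injective_map
    (d := X.cosyzygy.injHullMap ∘ₗ (LinearMap.range X.injHullMap).mkQ) ?_
  exact (LinearMap.exact_map_mkQ_range _).comp_injective X.cosyzygy.injHullMap hI'.injective_map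
    (map_zero X.cosyzygy.injHullMap)

end FDMod

end DomDim

/-! ### Duality pairings -/

section Duality

variable {K R S : Type*} [Field K] [Ring R] [Algebra K R] [Ring S] [Algebra K S]

/-- A perfect pairing `B` that identifies the left `S`-module `D` with the `K`-dual of the left
`R`-module `M`, where `ρ : S ≃ R` is an anti-isomorphism. Working with pairings instead of the
dual itself treats the two sides symmetrically and avoids double duals and iterated opposites. -/
structure IsDualPairing (ρ : S ≃ₗ[K] R) {D M : Type*} [AddCommGroup D] [Module K D] [Module S D]
    [AddCommGroup M] [Module K M] [Module R M] (B : D →ₗ[K] M →ₗ[K] K) : Prop where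
  map_mul : ∀ a b, ρ (a * b) = ρ b * ρ a
  smul_apply : ∀ s x m, B (s • x) m = B x (ρ s • m)
  isPerfPair : B.IsPerfPair

namespace IsDualPairing

variable {ρ : S ≃ₗ[K] R} {D M : Type*} [AddCommGroup D] [Module K D] [Module S D]
  [AddCommGroup M] [Module K M] [Module R M] {B : D →ₗ[K] M →ₗ[K] K}

theorem flip (h : IsDualPairing ρ B) : IsDualPairing ρ.symm B.flip where
  map_mul a b := ρ.injective <| by
    simp only [h.map_mul, LinearEquiv.apply_symm_apply]
  smul_apply r m x := by
    rw [LinearMap.flip_apply, LinearMap.flip_apply, h.smul_apply, LinearEquiv.apply_symm_apply]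
  isPerfPair := h.isPerfPair.flip

theorem ext_left (h : IsDualPairing ρ B) {x y : D} (hxy : ∀ m, B x m = B y m) : x = y :=
  h.isPerfPair.bijective_left.injective (LinearMap.ext hxy)

theorem exists_apply_eq (h : IsDualPairing ρ B) (l : M →ₗ[K] K) : ∃ x, ∀ m, B x m = l m :=
  (h.isPerfPair.bijective_left.surjective l).imp fun _ hx => LinearMap.congr_fun hx

theorem eq_top_of_forall_eq_zero [IsScalarTower K R M] (h : IsDualPairing ρ B)
    {N : Submodule R M} (hN : ∀ x, (∀ n ∈ N, B x n = 0) → x = 0) : N = ⊤ := by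
  by_contra hne
  obtain ⟨m, -, hm⟩ := SetLike.exists_of_lt (lt_top_iff_ne_top.2 hne)
  obtain ⟨l, hlm, hlN⟩ := exists_functional_of_notMem (K := K) N hm
  obtain ⟨x, hx⟩ := h.exists_apply_eq l
  rw [← hx, hN x fun n hn => (hx n).trans (hlN n hn), map_zero, LinearMap.zero_apply] at hlm
  exact hlm rfl

/-- The submodule of `D` orthogonal to a submodule of `M`. -/
def annihilator (h : IsDualPairing ρ B) (N : Submodule R M) : Submodule S D where
  carrier := {x | ∀ n ∈ N, B x n = 0}
  add_mem' hx hy n hn := by rw [map_add, LinearMap.add_apply, hx n hn, hy n hn, add_zero]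
  zero_mem' n _ := by rw [map_zero, LinearMap.zero_apply]
  smul_mem' s x hx n hn := (h.smul_apply s x n).trans (hx _ (N.smul_mem _ hn))

section DualMap

variable [IsScalarTower K R M] {D' M' : Type*} [AddCommGroup D'] [Module K D'] [Module S D']
  [AddCommGroup M'] [Module K M'] [Module R M'] [IsScalarTower K R M'] {B' : D' →ₗ[K] M' →ₗ[K] K}

/-- The transpose of an `R`-linear map with respect to two duality pairings. -/
noncomputable def dualMap (h : IsDualPairing ρ B) (h' : IsDualPairing ρ B') (f : M →ₗ[R] M') :
    D' →ₗ[S] D :=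
  have := h.isPerfPair
  { toFun := fun x => B.toPerfPair.symm (B' x ∘ₗ f.restrictScalars K)
    map_add' := fun x y => by rw [map_add, LinearMap.add_comp, map_add]
    map_smul' := fun s x => h.ext_left fun m => by
      rw [RingHom.id_apply, h.smul_apply, LinearMap.apply_symm_toPerfPair_self,
        LinearMap.apply_symm_toPerfPair_self]
      simp only [LinearMap.comp_apply, LinearMap.coe_restrictScalars, h'.smul_apply, map_smul] }

theorem dualMap_apply (h : IsDualPairing ρ B) (h' : IsDualPairing ρ B') (f : M →ₗ[R] M') (x : D')
    (m : M) : B (h.dualMap h' f x) m = B' x (f m) :=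
  have := h.isPerfPair
  LinearMap.congr_fun (B.apply_symm_toPerfPair_self _) m

theorem dualMap_injective (h : IsDualPairing ρ B) (h' : IsDualPairing ρ B') {f : M →ₗ[R] M'}
    (hf : Function.Surjective f) : Function.Injective (h.dualMap h' f) :=
  (injective_iff_map_eq_zero _).2 fun x hx => h'.ext_left fun m' => by
    obtain ⟨m, rfl⟩ := hf m'
    rw [← h.dualMap_apply h' f x m, hx, map_zero, LinearMap.zero_apply, map_zero,
      LinearMap.zero_apply]

/-- The transpose of an `R`-linear equivalence with respect to two duality pairings. -/
noncomputable def dualEquiv (h : IsDualPairing ρ B) (h' : IsDualPairing ρ B') (f : M ≃ₗ[R] M') :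
    D' ≃ₗ[S] D :=
  .ofLinearMap (h.dualMap h' f.toLinearMap) (h'.dualMap h f.symm.toLinearMap)
    (LinearMap.ext fun x => h.ext_left fun m => by
      simp only [LinearMap.comp_apply, dualMap_apply, LinearEquiv.coe_coe,
        LinearEquiv.symm_apply_apply, LinearMap.id_apply])
    (LinearMap.ext fun x => h'.ext_left fun m => by
      simp only [LinearMap.comp_apply, dualMap_apply, LinearEquiv.coe_coe,
        LinearEquiv.apply_symm_apply, LinearMap.id_apply])

theorem nonempty_equiv_iff [IsScalarTower K S D] [IsScalarTower K S D'] (h : IsDualPairing ρ B)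
    (h' : IsDualPairing ρ B') : Nonempty (D ≃ₗ[S] D') ↔ Nonempty (M ≃ₗ[R] M') :=
  ⟨fun ⟨f⟩ => ⟨(h.flip.dualEquiv h'.flip f).symm⟩, fun ⟨f⟩ => ⟨(h.dualEquiv h' f).symm⟩⟩

end DualMap

theorem congr_right (h : IsDualPairing ρ B) [IsScalarTower K R M] {M' : Type*} [AddCommGroup M']
    [Module K M'] [Module R M'] [IsScalarTower K R M'] (f : M' ≃ₗ[R] M) :
    IsDualPairing ρ (B.compl₂ (f.restrictScalars K).toLinearMap) where
  map_mul := h.map_mul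
  smul_apply s x _ := (h.smul_apply s x _).trans (congrArg (B x) (map_smul f _ _).symm)
  isPerfPair :=
    have := h.isPerfPair
    inferInstanceAs (B.compl₁₂ (LinearEquiv.refl K D).toLinearMap
      (f.restrictScalars K).toLinearMap).IsPerfPair

theorem exists_quotient (h : IsDualPairing ρ B) [IsScalarTower K S D] [IsScalarTower K R M]
    [FiniteDimensional K M] {N : Submodule S D} {Q : Submodule R M}
    (hQ : ∀ m, m ∈ Q ↔ ∀ x ∈ N, B x m = 0) :
    ∃ B' : (D ⧸ N) →ₗ[K] Q →ₗ[K] K, IsDualPairing ρ B' := by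
  let B₀ : D →ₗ[K] Q →ₗ[K] K := B.compl₂ (Q.subtype.restrictScalars K)
  let B' : (D ⧸ N) →ₗ[K] Q →ₗ[K] K := (N.restrictScalars K).liftQ B₀ (fun x hx =>
    LinearMap.ext fun q => (hQ q).1 q.2 x hx) ∘ₗ
      (Submodule.Quotient.restrictScalarsEquiv K N).symm.toLinearMap
  have hB' (x : D) (q : Q) : B' (N.mkQ x) q = B x q := rfl
  refine ⟨B', h.map_mul, fun s y q => ?_, ?_⟩
  · obtain ⟨x, rfl⟩ := N.mkQ_surjective y
    rw [← map_smul, hB', hB', h.smul_apply]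
    rfl
  · have : FiniteDimensional K Q := inferInstanceAs (FiniteDimensional K (Q.restrictScalars K))
    refine .of_injective' ((injective_iff_map_eq_zero _).2 fun y hy => ?_)
      ((injective_iff_map_eq_zero _).2 fun q hq => Subtype.ext ?_)
    · obtain ⟨x, rfl⟩ := N.mkQ_surjective y
      refine (Submodule.Quotient.mk_eq_zero N).2 (by_contra fun hx => ?_)
      obtain ⟨l, hlx, hlN⟩ := exists_functional_of_notMem (K := K) N hx
      obtain ⟨m, hm⟩ := h.flip.exists_apply_eq l
      have hmQ : m ∈ Q := (hQ m).2 fun z hz => (hm z).trans (hlN z hz)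
      exact hlx ((hm x).symm.trans (LinearMap.congr_fun hy ⟨m, hmQ⟩))
    · refine h.flip.ext_left fun x => ?_
      rw [ZeroMemClass.coe_zero, map_zero]
      exact LinearMap.congr_fun hq (N.mkQ x)

end IsDualPairing

end Duality

section ProjectiveInjective

variable {K R S : Type u} [Field K] [Ring R] [Algebra K R] [Ring S] [Algebra K S]
  {ρ : S ≃ₗ[K] R}

/-- The `K`-dual of a left `S`-module, as a left module over the opposite `R` of `S`. -/
def FDMod.dualAlong (σ : R ≃ₗ[K] S) (hσ : ∀ a b, σ (a * b) = σ b * σ a)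
    (X : FDMod K S) : FDMod K R where
  carrier := X →ₗ[K] K
  module :=
    { smul := fun r f => f ∘ₗ Module.toModuleEnd K X (σ r)
      one_smul := fun f => LinearMap.ext fun x => congrArg f <|
        have hone : σ 1 = 1 := by
          simpa only [mul_one, σ.apply_symm_apply] using (hσ (σ.symm 1) 1).symm
        (congrArg (· • x) hone).trans (one_smul S x)
      mul_smul := fun r r' f => LinearMap.ext fun x => congrArg f <|
        (congrArg (· • x) (hσ r r')).trans (mul_smul _ _ x)
      smul_zero := fun _ => rfl
      smul_add := fun _ _ _ => rfl
      add_smul := fun r r' f => LinearMap.ext fun x =>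
        (congrArg f ((congrArg (· • x) (map_add σ r r')).trans (add_smul _ _ x))).trans
          (map_add f _ _)
      zero_smul := fun f => LinearMap.ext fun x =>
        (congrArg f ((congrArg (· • x) (map_zero σ)).trans (zero_smul S x))).trans
          (map_zero f) }
  isScalarTower := @IsScalarTower.mk _ _ _ _ (_) _ fun k r f => LinearMap.ext fun x =>
    (congrArg f ((congrArg (· • x) (map_smul σ k r)).trans (smul_assoc k (σ r) x))).trans
      (map_smul f k _)

theorem exists_isDualPairing (hρ : ∀ a b, ρ (a * b) = ρ b * ρ a) (X : FDMod K S) :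
    ∃ (M : FDMod K R) (B : X →ₗ[K] M →ₗ[K] K), IsDualPairing ρ B := by
  have hρ' (a b : R) : ρ.symm (a * b) = ρ.symm b * ρ.symm a := ρ.injective <| by
    simp only [hρ, ρ.apply_symm_apply]
  refine ⟨X.dualAlong ρ.symm hρ',
    (LinearMap.id : (X →ₗ[K] K) →ₗ[K] X →ₗ[K] K).flip, hρ, fun s x f => ?_, ?_⟩
  · exact congrArg (fun s' : S => (show X →ₗ[K] K from f) (s' • x)) (ρ.symm_apply_apply s).symm
  · exact inferInstanceAs (LinearMap.flip (.id : Module.Dual K X →ₗ[K] _)).IsPerfPair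

namespace IsDualPairing

variable {D M : Type u} [AddCommGroup D] [Module K D] [Module S D] [IsScalarTower K S D]
  [AddCommGroup M] [Module K M] [Module R M] [IsScalarTower K R M] {B : D →ₗ[K] M →ₗ[K] K}

/-- Baer's criterion: if `(pᵢ, hᵢ)` is a dual basis of `M` and `q` a `K`-linear retraction onto the
left ideal `I`, then `g : I → D` is multiplication by the element of `D` that corresponds to the
functional `m ↦ ∑ i, ⟨g (q (hᵢ m)), pᵢ⟩`. -/
theorem injective_of_projective (h : IsDualPairing ρ B) [Module.Projective R M]
    [Module.Finite R M] : Module.Injective S D := by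
  obtain ⟨b⟩ := CornerBasis.nonempty_one R M
  refine Module.Baer.injective fun I g => ?_
  obtain ⟨q, hq⟩ := (I.subtype.restrictScalars K).exists_leftInverse_of_injective
    (LinearMap.ker_eq_bot.2 Subtype.val_injective)
  obtain ⟨d, hd⟩ := h.exists_apply_eq (∑ i, B.flip (b.vec i) ∘ₗ g.restrictScalars K ∘ₗ q ∘ₗ
    ρ.symm.toLinearMap ∘ₗ (b.coord i).restrictScalars K)
  refine ⟨LinearMap.toSpanSingleton S D d, fun s hs => h.ext_left fun m => ?_⟩
  calc B (s • d) m
      = ∑ i, B (g (q (ρ.symm (b.coord i m) * s))) (b.vec i) := by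
        simp only [h.smul_apply, hd, LinearMap.sum_apply, LinearMap.comp_apply,
          LinearMap.flip_apply, LinearMap.coe_restrictScalars, LinearEquiv.coe_coe, map_smul,
          smul_eq_mul, h.flip.map_mul, ρ.symm_apply_apply]
    _ = ∑ i, B (g ⟨s, hs⟩) (b.coord i m • b.vec i) := Finset.sum_congr rfl fun i _ => by
        have hqs : q (ρ.symm (b.coord i m) * s) = ρ.symm (b.coord i m) • ⟨s, hs⟩ :=
          LinearMap.congr_fun hq (ρ.symm (b.coord i m) • (⟨s, hs⟩ : I))
        rw [hqs, map_smul, h.smul_apply, ρ.apply_symm_apply]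
    _ = B (g ⟨s, hs⟩) m := by rw [← map_sum, b.sum_coord_smul]

theorem projective_of_injective (h : IsDualPairing ρ B) [FiniteDimensional K S]
    [FiniteDimensional K D] (hM : Module.Injective R M) : Module.Projective S D := by
  have : Module.Finite S D := .of_restrictScalars_finite K S D
  obtain ⟨n, f, hf⟩ := Module.Finite.exists_fin' S D
  obtain ⟨M', B', h'⟩ := exists_isDualPairing h.map_mul (FDMod.of K S (Fin n → S))
  let i : M →ₗ[R] M' := h'.flip.dualMap h.flip f
  obtain ⟨r, hr⟩ := hM.out i (h'.flip.dualMap_injective h.flip hf) LinearMap.id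
  refine .of_split (h'.dualMap h r) f (LinearMap.ext fun x => h.ext_left fun m => ?_)
  calc B (f (h'.dualMap h r x)) m = B' (h'.dualMap h r x) (i m) :=
        (h'.flip.dualMap_apply h.flip f m _).symm
    _ = B x (r (i m)) := h'.dualMap_apply h r x (i m)
    _ = B x m := congrArg (B x) (hr m)

theorem injective_iff_projective (h : IsDualPairing ρ B) [FiniteDimensional K R]
    [FiniteDimensional K M] : Module.Injective S D ↔ Module.Projective R M :=
  ⟨h.flip.projective_of_injective, fun _ =>
    have : Module.Finite R M := .of_restrictScalars_finite K R M
    h.injective_of_projective⟩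

end IsDualPairing

end ProjectiveInjective

/-! ### Duality exchanges injective hulls and projective covers -/

namespace IsProjectiveCover

variable {R : Type u} [Ring R] {P Q M : Type u} [AddCommGroup P] [Module R P] [AddCommGroup Q]
  [Module R Q] [AddCommGroup M] [Module R M] {f : P →ₗ[R] M}

theorem surjective_of_surjective_comp (hf : IsProjectiveCover f) {g : Q →ₗ[R] P}
    (hfg : Function.Surjective (f ∘ₗ g)) : Function.Surjective g := by
  refine LinearMap.range_eq_top.1 (hf.superfluous _ (Submodule.eq_top_iff'.2 fun p => ?_))
  obtain ⟨q, hq⟩ := hfg (f p)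
  refine Submodule.mem_sup.2 ⟨g q, ⟨q, rfl⟩, p - g q, ?_, add_sub_cancel _ _⟩
  rw [LinearMap.mem_ker, map_sub, sub_eq_zero]
  exact hq.symm

theorem exists_equiv (hf : IsProjectiveCover f) {g : Q →ₗ[R] M} (hg : IsProjectiveCover g) :
    ∃ φ : Q ≃ₗ[R] P, ∀ x, f (φ x) = g x := by
  have := hf.projective
  have := hg.projective
  obtain ⟨φ, hφ⟩ := Module.projective_lifting_property f g hf.surjective
  have hφ_surj : Function.Surjective φ :=
    hf.surjective_of_surjective_comp (hφ.symm ▸ hg.surjective)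
  obtain ⟨s, hs⟩ := Module.projective_lifting_property φ LinearMap.id hφ_surj
  have hs_surj : Function.Surjective s := hg.surjective_of_surjective_comp <| by
    rw [← hφ, LinearMap.comp_assoc, hs]
    exact hf.surjective
  have hφ_inj : Function.Injective φ := fun x y hxy => by
    obtain ⟨x, rfl⟩ := hs_surj x
    obtain ⟨y, rfl⟩ := hs_surj y
    exact congrArg s ((LinearMap.congr_fun hs x).symm.trans (hxy.trans (LinearMap.congr_fun hs y)))
  exact ⟨.ofBijective φ ⟨hφ_inj, hφ_surj⟩, LinearMap.congr_fun hφ⟩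

end IsProjectiveCover

section Hulls

variable {K R S : Type u} [Field K] [Ring R] [Algebra K R] [FiniteDimensional K R] [Ring S]
  [Algebra K S] {ρ : S ≃ₗ[K] R}

theorem IsInjectiveHull.isProjectiveCover {X I M P : Type u} [AddCommGroup X] [Module K X]
    [Module S X] [AddCommGroup I] [Module K I] [Module S I] [IsScalarTower K S I]
    [AddCommGroup M] [Module K M] [Module R M] [IsScalarTower K R M]
    [AddCommGroup P] [Module K P] [Module R P] [IsScalarTower K R P] [FiniteDimensional K P]
    {B : X →ₗ[K] M →ₗ[K] K} {B' : I →ₗ[K] P →ₗ[K] K} (h : IsDualPairing ρ B)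
    (h' : IsDualPairing ρ B') {f : X →ₗ[S] I} {g : P →ₗ[R] M}
    (hfg : ∀ x p, B' (f x) p = B x (g p)) (hf : IsInjectiveHull f) : IsProjectiveCover g where
  projective := h'.injective_iff_projective.1 hf.injective
  surjective := LinearMap.range_eq_top.1 <| h.eq_top_of_forall_eq_zero fun x hx => by
    refine (injective_iff_map_eq_zero f).1 hf.injective_map x (h'.ext_left fun p => ?_)
    rw [hfg, hx _ ⟨p, rfl⟩, map_zero, LinearMap.zero_apply]
  superfluous N hN := by
    suffices hbot : h'.annihilator N = ⊥ from h'.eq_top_of_forall_eq_zero fun y hy =>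
      (Submodule.mem_bot S).1 (hbot ▸ hy : y ∈ (⊥ : Submodule S I))
    refine hf.essential _ (eq_bot_iff.2 ?_)
    rintro _ ⟨hy, x, rfl⟩
    refine h'.ext_left fun p => ?_
    obtain ⟨n, hn, k, hk, rfl⟩ := Submodule.mem_sup.1 (hN ▸ Submodule.mem_top : p ∈ N ⊔ _)
    rw [map_add, hy n hn, hfg, LinearMap.mem_ker.1 hk, map_zero, map_zero, LinearMap.zero_apply,
      add_zero]

namespace IsDualPairing

variable [FiniteDimensional K S] {X : FDMod K S} {M : FDMod K R} {B : X →ₗ[K] M →ₗ[K] K}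

theorem exists_injHull_projCover (h : IsDualPairing ρ B) :
    ∃ B' : X.injHull →ₗ[K] M.projCover →ₗ[K] K, IsDualPairing ρ B' ∧
      ∀ x p, B' (X.injHullMap x) p = B x (M.projCoverMap p) := by
  obtain ⟨P, B', h'⟩ := exists_isDualPairing h.map_mul X.injHull
  let g : P →ₗ[R] M := h.flip.dualMap h'.flip X.injHullMap
  have hg (x : X) (p : P) : B' (X.injHullMap x) p = B x (g p) :=
    (h.flip.dualMap_apply h'.flip X.injHullMap p x).symm
  obtain ⟨φ, hφ⟩ := (X.isInjectiveHull_injHullMap.isProjectiveCover h h' hg).exists_equiv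
    M.isProjectiveCover_projCoverMap
  exact ⟨_, h'.congr_right φ, fun x p => (hg x (φ p)).trans (congrArg (B x) (hφ p))⟩

theorem exists_cosyzygy_syzygy (h : IsDualPairing ρ B) :
    ∃ B' : X.cosyzygy →ₗ[K] M.syzygy →ₗ[K] K, IsDualPairing ρ B' := by
  obtain ⟨B', h', hB'⟩ := h.exists_injHull_projCover
  refine h'.exists_quotient fun p => ⟨?_, fun hp => h.flip.ext_left fun x => ?_⟩
  · rintro hp _ ⟨x, rfl⟩
    rw [hB', LinearMap.mem_ker.1 hp, map_zero]
  · rw [map_zero, LinearMap.zero_apply, LinearMap.flip_apply, ← hB']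
    exact hp _ ⟨x, rfl⟩

theorem two_le_domDim_iff (h : IsDualPairing ρ B) : 2 ≤ X.domDim ↔
    Module.Injective R M.projCover ∧ Module.Injective R M.syzygy.projCover := by
  obtain ⟨B₀, h₀, -⟩ := h.exists_injHull_projCover
  obtain ⟨Bs, hs⟩ := h.exists_cosyzygy_syzygy
  obtain ⟨B₁, h₁, -⟩ := hs.exists_injHull_projCover
  rw [X.two_le_domDim_iff, h₀.flip.injective_iff_projective, h₁.flip.injective_iff_projective]

end IsDualPairing

end Hulls

/-! ### The Nakayama functor on summands of sums of copies of `Re` -/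

namespace CornerBasis

variable {K R : Type u} [Field K] [Ring R] [Algebra K R] {e : R} {t : R →ₗ[K] K}
  {P Q : Type u} [AddCommGroup P] [Module K P] [Module R P] [IsScalarTower K R P]
  [AddCommGroup Q] [Module K Q] [Module R Q] [IsScalarTower K R Q]

/-- The pairing of `P` with `Hom_R(P, R)` which identifies a summand `P` of `(Re)ⁿ` with its image
`D Hom_R(P, R)` under the Nakayama functor. It does not depend on the dual basis, since
`nakayama_smul_left` and `nakayama_smul_self` determine it. -/
noncomputable def nakayama (b : CornerBasis e P) (t : R →ₗ[K] K) :
    P →ₗ[K] (P →ₗ[R] R) →ₗ[K] K :=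
  LinearMap.mk₂ K (fun x f => ∑ i, t (f (b.vec i) * b.coord i x))
    (fun x y f => by simp only [map_add, mul_add, Finset.sum_add_distrib])
    (fun k x f => by
      simp only [LinearMap.map_smul_of_tower, mul_smul_comm, map_smul, Finset.smul_sum])
    (fun x f g => by simp only [LinearMap.add_apply, add_mul, map_add, Finset.sum_add_distrib])
    (fun k x f => by simp only [LinearMap.smul_apply, smul_mul_assoc, map_smul, Finset.smul_sum])

theorem nakayama_apply (b : CornerBasis e P) (x : P) (f : P →ₗ[R] R) :
    b.nakayama t x f = ∑ i, t (f (b.vec i) * b.coord i x) := rfl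

theorem nakayama_smul_left (b : CornerBasis e P) (r : R) (x : P) (f : P →ₗ[R] R) :
    b.nakayama t (r • x) f = b.nakayama t x (op r • f) := by
  simp only [nakayama_apply, map_smul, LinearMap.smul_apply, smul_eq_mul, op_smul_eq_mul,
    mul_assoc]

theorem nakayama_smul_self (H : IsSymmetricIdempotent K e t) (b : CornerBasis e P) (x : P)
    (f : P →ₗ[R] R) : b.nakayama t (e • x) f = t (f x) := by
  rw [nakayama_apply, b.map_eq_sum f x, map_sum]
  refine Finset.sum_congr rfl fun i _ => ?_
  rw [map_smul, smul_eq_mul, ← mul_assoc, H.symm, b.coord_mul, smul_eq_mul]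

theorem nakayama_map (H : IsSymmetricIdempotent K e t) (b : CornerBasis e P)
    (c : CornerBasis e Q) (d : P →ₗ[R] Q) (x : P) (f : Q →ₗ[R] R) :
    c.nakayama t (d x) f = b.nakayama t x (f ∘ₗ d) := by
  have hx : x ∈ traceSub e P := b.traceSub_eq_top ▸ Submodule.mem_top
  induction hx using Submodule.closure_induction with
  | zero => simp only [map_zero, LinearMap.zero_apply]
  | add x y _ _ hx hy => simp only [map_add, LinearMap.add_apply, hx, hy]
  | smul_mem r _ hx =>
    obtain ⟨y, rfl⟩ := hx
    simp only [map_smul, nakayama_smul_left c r, nakayama_smul_left b r, nakayama_smul_self H,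
      LinearMap.smul_apply, LinearMap.comp_apply]

theorem nakayama_injective (H : IsSymmetricIdempotent K e t) (b : CornerBasis e P) :
    Function.Injective (b.nakayama t) := by
  refine (injective_iff_map_eq_zero _).2 fun x hx => ?_
  rw [← b.sum_coord_smul x]
  refine Finset.sum_eq_zero fun i _ => ?_
  rw [← b.coord_mul, H.nondeg_right (b.coord i x) fun y => ?_, zero_smul]
  calc t (y * b.coord i x) = b.nakayama t (e • y • x) (b.coord i) := by
        rw [nakayama_smul_self H, map_smul, smul_eq_mul]
    _ = b.nakayama t x (op y • op e • b.coord i) := by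
        rw [nakayama_smul_left, nakayama_smul_left]
    _ = 0 := by rw [hx, LinearMap.zero_apply]

theorem nakayama_flip_injective (H : IsSymmetricIdempotent K e t) (b : CornerBasis e P) :
    Function.Injective (b.nakayama t).flip := by
  refine (injective_iff_map_eq_zero _).2 fun f hf => LinearMap.ext fun x => ?_
  rw [b.map_eq_sum f x, LinearMap.zero_apply]
  refine Finset.sum_eq_zero fun i _ => ?_
  rw [← b.smul_vec i, map_smul f, smul_eq_mul e, H.nondeg_left _ fun y => ?_, smul_zero]
  calc t (f (b.vec i) * y) = b.nakayama t (y • e • b.vec i) f := by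
        rw [nakayama_smul_left, nakayama_smul_self H, LinearMap.smul_apply, op_smul_eq_mul]
    _ = 0 := LinearMap.congr_fun hf _

variable [FiniteDimensional K P]

theorem isDualPairing_nakayama (H : IsSymmetricIdempotent K e t) (b : CornerBasis e P) :
    IsDualPairing (opLinearEquiv K : R ≃ₗ[K] Rᵐᵒᵖ) (b.nakayama t) where
  map_mul _ _ := rfl
  smul_apply := b.nakayama_smul_left
  isPerfPair := .of_injective (b.nakayama_injective H) (b.nakayama_flip_injective H)

theorem injective [FiniteDimensional K R] (H : IsSymmetricIdempotent K e t)
    (b : CornerBasis e P) : Module.Injective R P :=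
  have := b.dual.projective
  have : FiniteDimensional K (P →ₗ[R] R) := FDMod.finite_hom_of_left (.of K R P)
  have : Module.Finite Rᵐᵒᵖ (P →ₗ[R] R) := .of_restrictScalars_finite K _ _
  (b.isDualPairing_nakayama H).injective_of_projective

end CornerBasis

/-! ### Kernels of the Nakayama functor on presentations -/

section NakayamaKernel

variable {K R : Type*} [Field K] [Ring R] [Algebra K R] {e : R}

/-- `i` identifies `T` with the kernel of `ν d : ν P₁ → ν P₀`, where `ν = D Hom_R(-, R)` is the
Nakayama functor. For a minimal projective presentation `d` of `M` this says `T ≅ D Tr M`. -/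
structure IsNakayamaKernel {P₁ P₀ T : Type*} [AddCommGroup P₁] [Module R P₁] [AddCommGroup P₀]
    [Module R P₀] [AddCommGroup T] [Module K T] [Module R T] (d : P₁ →ₗ[R] P₀)
    (i : T →ₗ[K] (P₁ →ₗ[R] R) →ₗ[K] K) : Prop where
  injective : Function.Injective i
  mem_range_iff : ∀ l, l ∈ LinearMap.range i ↔ ∀ f : P₀ →ₗ[R] R, l (f ∘ₗ d) = 0
  smul_apply : ∀ (r : R) x f, i (r • x) f = i x (op r • f)

theorem exists_comp_eq_of_exact {P₁ P₀ M Q : Type*} [AddCommGroup P₁] [Module R P₁]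
    [AddCommGroup P₀] [Module R P₀] [AddCommGroup M] [Module R M] [AddCommGroup Q] [Module R Q]
    {d : P₁ →ₗ[R] P₀} {π : P₀ →ₗ[R] M} (hd : Function.Exact d π) (hπ : Function.Surjective π)
    {f : P₀ →ₗ[R] Q} (hf : f ∘ₗ d = 0) : ∃ g : M →ₗ[R] Q, g ∘ₗ π = f := by
  refine ⟨(LinearMap.range d).liftQ f (LinearMap.range_le_ker_iff.2 hf) ∘ₗ
    (hd.linearEquivOfSurjective hπ).symm.toLinearMap, LinearMap.ext fun x => ?_⟩
  rw [LinearMap.comp_apply, LinearMap.comp_apply, LinearEquiv.coe_coe,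
    hd.linearEquivOfSurjective_symm_apply, Submodule.liftQ_apply]

theorem smul_mem_traceSub_of_mem {P Q : Type*} [AddCommGroup P] [Module R P] [AddCommGroup Q]
    [Module R Q] {f : P →ₗ[R] R} (hf : f ∈ traceSub (op e) (P →ₗ[R] R)) (x : P) (q : Q) :
    f x • q ∈ traceSub e Q := by
  induction hf using Submodule.closure_induction with
  | zero => simp only [LinearMap.zero_apply, zero_smul, zero_mem]
  | add f g _ _ hf hg =>
    rw [LinearMap.add_apply, add_smul]
    exact add_mem hf hg
  | smul_mem r _ hf =>
    obtain ⟨g, rfl⟩ := hf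
    rw [LinearMap.smul_apply, LinearMap.smul_apply, op_smul_eq_mul, smul_eq_mul_unop, mul_smul,
      mul_smul]
    exact Submodule.smul_mem _ _ (smul_mem_traceSub e _)

theorem exists_sub_comp_mem_traceSub {P P' Q : Type*} [AddCommGroup P] [Module R P]
    [AddCommGroup P'] [Module R P'] [AddCommGroup Q] [Module R Q] [Module.Projective R Q]
    [Module.Finite R Q] {d : P →ₗ[R] P'}
    (hd : ∀ h : P →ₗ[R] R, ∃ f : P' →ₗ[R] R, h - f ∘ₗ d ∈ traceSub (op e) (P →ₗ[R] R))
    (q : P →ₗ[R] Q) : ∃ c : P' →ₗ[R] Q, ∀ x, q x - c (d x) ∈ traceSub e Q := by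
  obtain ⟨b⟩ := CornerBasis.nonempty_one R Q
  choose f hf using fun i => hd (b.coord i ∘ₗ q)
  refine ⟨∑ i, (f i).smulRight (b.vec i), fun x => ?_⟩
  have hsum : q x - (∑ i, (f i).smulRight (b.vec i)) (d x) =
      ∑ i, (b.coord i ∘ₗ q - f i ∘ₗ d) x • b.vec i := by
    simp only [LinearMap.sum_apply, LinearMap.smulRight_apply, LinearMap.sub_apply,
      LinearMap.comp_apply, sub_smul, Finset.sum_sub_distrib, b.sum_coord_smul]
  rw [hsum]
  exact Submodule.sum_mem _ fun i _ => smul_mem_traceSub_of_mem (hf i) x _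

end NakayamaKernel

namespace IsNakayamaKernel

variable {K R : Type u} [Field K] [Ring R] [Algebra K R] {e : R} {t : R →ₗ[K] K} {P₁ P₀ T : Type u}
  [AddCommGroup P₁] [Module R P₁] [AddCommGroup P₀] [Module R P₀] [AddCommGroup T] [Module K T]
  [Module R T] {d : P₁ →ₗ[R] P₀} {i : T →ₗ[K] (P₁ →ₗ[R] R) →ₗ[K] K}

theorem apply_comp (hi : IsNakayamaKernel d i) (x : T) (f : P₀ →ₗ[R] R) : i x (f ∘ₗ d) = 0 :=
  (hi.mem_range_iff (i x)).1 ⟨x, rfl⟩ f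

theorem nonempty_equiv_ker [Module K P₁] [IsScalarTower K R P₁] [FiniteDimensional K P₁]
    [Module K P₀] [IsScalarTower K R P₀] (H : IsSymmetricIdempotent K e t)
    (hi : IsNakayamaKernel d i) (b₁ : CornerBasis e P₁) (b₀ : CornerBasis e P₀) :
    Nonempty (T ≃ₗ[R] LinearMap.ker d) := by
  have h₁ := b₁.isDualPairing_nakayama H
  have := h₁.isPerfPair
  let ψ : T →ₗ[R] P₁ :=
    { toFun := fun x => (b₁.nakayama t).toPerfPair.symm (i x)
      map_add' := fun x y => by rw [map_add, map_add]
      map_smul' := fun r x => h₁.ext_left fun f => by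
        rw [RingHom.id_apply, LinearMap.apply_symm_toPerfPair_self, hi.smul_apply,
          CornerBasis.nakayama_smul_left, LinearMap.apply_symm_toPerfPair_self] }
  have hψ (x : T) : b₁.nakayama t (ψ x) = i x := LinearMap.apply_symm_toPerfPair_self _ _
  have hψ_inj : Function.Injective ψ := fun x y hxy => hi.injective <| by rw [← hψ, hxy, hψ]
  have hψ_range : LinearMap.range ψ = LinearMap.ker d := by
    ext p
    calc p ∈ LinearMap.range ψ ↔ b₁.nakayama t p ∈ LinearMap.range i := exists_congr fun x => by
          rw [← hψ, (b₁.nakayama_injective H).eq_iff]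
      _ ↔ b₀.nakayama t (d p) = 0 := by
          rw [hi.mem_range_iff, LinearMap.ext_iff]
          simp only [b₁.nakayama_map H b₀, LinearMap.zero_apply]
      _ ↔ p ∈ LinearMap.ker d := by
          rw [LinearMap.mem_ker, map_eq_zero_iff _ (b₀.nakayama_injective H)]
  exact ⟨(LinearEquiv.ofInjective ψ hψ_inj).trans (.ofEq _ _ hψ_range)⟩

theorem exists_sub_comp_mem_of_isTorsionFree (hi : IsNakayamaKernel d i)
    (hT : IsTorsionFree e T) (h : P₁ →ₗ[R] R) :
    ∃ f : P₀ →ₗ[R] R, h - f ∘ₗ d ∈ traceSub (op e) (P₁ →ₗ[R] R) := by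
  suffices hmem : h ∈ LinearMap.range (LinearMap.lcomp Rᵐᵒᵖ R d) ⊔ traceSub (op e) _ by
    obtain ⟨_, ⟨f, rfl⟩, g, hg, rfl⟩ := Submodule.mem_sup.1 hmem
    exact ⟨f, (add_sub_cancel_left (f ∘ₗ d) g).symm ▸ hg⟩
  by_contra hmem
  obtain ⟨l, hlh, hl⟩ := exists_functional_of_notMem (K := K) _ hmem
  obtain ⟨x, rfl⟩ := (hi.mem_range_iff l).2 fun f => hl _ (Submodule.mem_sup_left ⟨f, rfl⟩)
  refine hlh ?_
  rw [hT x fun r => hi.injective (LinearMap.ext fun f => ?_), map_zero, LinearMap.zero_apply]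
  rw [hi.smul_apply, map_zero, LinearMap.zero_apply, op_mul, mul_smul]
  exact hl _ (Submodule.mem_sup_right (Submodule.smul_mem _ _ (smul_mem_traceSub _ f)))

theorem exists_apply_smul_eq (he : IsIdempotentElem e) (hi : IsNakayamaKernel d i)
    (hT : IsCornerClosed K e T) {y : (P₁ →ₗ[R] R) →ₗ[K] K}
    (hy : ∀ f ∈ traceSub (op e) (P₀ →ₗ[R] R), y (f ∘ₗ d) = 0) :
    ∃ x, ∀ r f, i x (op (e * r) • f) = y (op (e * r) • f) := by
  let Y : R →ₗ[K] (P₁ →ₗ[R] R) →ₗ[K] K := LinearMap.mk₂ K (fun r f => y (op (e * r) • f))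
    (fun r s f => by rw [mul_add, op_add, add_smul, map_add])
    (fun k r f => by rw [mul_smul_comm, op_smul, smul_assoc, map_smul])
    (fun r f g => by rw [smul_add, map_add])
    (fun k r f => by rw [smul_comm, map_smul])
  have hY (r : R) : Y r ∈ LinearMap.range i := (hi.mem_range_iff _).2 fun f => by
    refine hy (op (e * r) • f) ?_
    rw [op_mul, mul_smul]
    exact Submodule.smul_mem _ _ (smul_mem_traceSub _ f)
  let G : R →ₗ[K] T :=
    (LinearEquiv.ofInjective i hi.injective).symm.toLinearMap ∘ₗ Y.codRestrict _ hY
  have hG (r : R) (f : P₁ →ₗ[R] R) : i (G r) f = y (op (e * r) • f) :=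
    LinearMap.congr_fun (congrArg Subtype.val
      ((LinearEquiv.ofInjective i hi.injective).apply_symm_apply (Y.codRestrict _ hY r))) f
  obtain ⟨x, hx⟩ := hT.exists_eq G fun s r => hi.injective <| LinearMap.ext fun f => by
    rw [hi.smul_apply, hG, hG, ← mul_smul, ← op_mul, ← mul_assoc, ← mul_assoc e (e * s) e,
      ← mul_assoc e e s, ← mul_assoc _ e r, he.eq, mul_assoc (e * s) e e, he.eq]
  exact ⟨x, fun r f => by rw [← hi.smul_apply, ← hx, hG, ← mul_assoc, he.eq]⟩

theorem apply_comp_eq_zero_of_isCornerClosed (he : IsIdempotentElem e) (hi : IsNakayamaKernel d i)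
    (hT : IsCornerClosed K e T) (hP : traceSub (op e) (P₁ →ₗ[R] R) = ⊤) {y : (P₁ →ₗ[R] R) →ₗ[K] K}
    (hy : ∀ f ∈ traceSub (op e) (P₀ →ₗ[R] R), y (f ∘ₗ d) = 0) (f : P₀ →ₗ[R] R) :
    y (f ∘ₗ d) = 0 := by
  obtain ⟨x, hx⟩ := hi.exists_apply_smul_eq he hT hy
  suffices hxy : i x = y by rw [← hxy, hi.apply_comp]
  ext g
  induction (hP ▸ Submodule.mem_top : g ∈ traceSub (op e) (P₁ →ₗ[R] R)) using
    Submodule.closure_induction with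
  | zero => rw [map_zero, map_zero]
  | add g h _ _ hg hh => rw [map_add, map_add, hg, hh]
  | smul_mem r _ hg =>
    obtain ⟨g, rfl⟩ := hg
    simpa only [op_mul, op_unop, mul_smul] using hx r.unop g

section Presentation

variable {M : Type u} [AddCommGroup M] [Module R M] {π : P₀ →ₗ[R] M}

theorem exists_sub_comp_mem_of_isCornerClosed (he : IsIdempotentElem e) (hi : IsNakayamaKernel d i)
    (hT : IsCornerClosed K e T) (hP : traceSub (op e) (P₁ →ₗ[R] R) = ⊤) (hd : Function.Exact d π)
    (hπ : Function.Surjective π) (h : P₀ →ₗ[R] R) :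
    ∃ f : M →ₗ[R] R, h - f ∘ₗ π ∈ traceSub (op e) (P₀ →ₗ[R] R) := by
  suffices hmem : h ∘ₗ d ∈ (traceSub (op e) _).map (LinearMap.lcomp Rᵐᵒᵖ R d) by
    obtain ⟨g, hg, hgd : g ∘ₗ d = h ∘ₗ d⟩ := hmem
    obtain ⟨f, hf⟩ := exists_comp_eq_of_exact hd hπ (f := h - g) <| by
      rw [LinearMap.sub_comp, hgd, sub_self]
    exact ⟨f, by rwa [hf, sub_sub_cancel]⟩
  by_contra hmem
  obtain ⟨y, hyh, hy⟩ := exists_functional_of_notMem (K := K) _ hmem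
  exact hyh (hi.apply_comp_eq_zero_of_isCornerClosed he hT hP
    (fun f hf => hy _ (Submodule.mem_map_of_mem hf)) h)

theorem traceSub_eq_top_of_isTorsionFree [Module.Projective R P₁] [Module.Finite R P₁]
    (hi : IsNakayamaKernel d i) (hT : IsTorsionFree e T) (hπ : IsProjectiveCover π)
    (hπd : π ∘ₗ d = 0) : traceSub e P₁ = ⊤ := by
  obtain ⟨c, hc⟩ := exists_sub_comp_mem_traceSub (hi.exists_sub_comp_mem_of_isTorsionFree hT) .id
  have hc_top : (traceSub e P₁).comap c = ⊤ := hπ.superfluous _ <|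
    Submodule.eq_top_iff'.2 fun x => Submodule.mem_sup.2
      ⟨x - d (c x), by simpa only [Submodule.mem_comap, map_sub, LinearMap.id_apply] using hc (c x),
        d (c x), LinearMap.congr_fun hπd (c x), sub_add_cancel _ _⟩
  refine Submodule.eq_top_iff'.2 fun x => ?_
  have hcd : c (d x) ∈ traceSub e P₁ := Submodule.eq_top_iff'.1 hc_top (d x)
  simpa only [LinearMap.id_apply, sub_add_cancel] using add_mem (hc x) hcd

theorem traceSub_eq_top_of_isCornerClosed [FiniteDimensional K R] [Module K P₀]
    [IsScalarTower K R P₀] [FiniteDimensional K P₀] [Module.Projective R P₀]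
    (H : IsSymmetricIdempotent K e t)
    (hi : IsNakayamaKernel d i) (hT : IsCornerClosed K e T) (hP : traceSub (op e) (P₁ →ₗ[R] R) = ⊤)
    (hd : Function.Exact d π) (hπ : Function.Surjective π)
    (hM : ∀ (Q : FDMod K R) (g : M →ₗ[R] Q), Function.Surjective g →
      Module.Projective R Q → Module.Injective R Q) : traceSub e P₀ = ⊤ := by
  let S : FDMod K R := .of K R (P₀ ⧸ traceSub e P₀)
  let p : P₀ →ₗ[R] S := (traceSub e P₀).mkQ
  have hp : Function.Surjective p := (traceSub e P₀).mkQ_surjective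
  have hS : traceSub e S = ⊥ := traceSub_quotient e P₀
  have hσ := S.isProjectiveCover_projCoverMap
  have := hσ.projective
  have : Module.Finite R S.projCover := .of_restrictScalars_finite K R _
  obtain ⟨q, hq⟩ := Module.projective_lifting_property S.projCoverMap p hσ.surjective
  obtain ⟨g, hg⟩ := exists_sub_comp_mem_traceSub
    (hi.exists_sub_comp_mem_of_isCornerClosed H.idem hT hP hd hπ) q
  have hgp (x : P₀) : S.projCoverMap (g (π x)) = p x := by
    have := map_mem_traceSub S.projCoverMap (hg x)
    rwa [hS, Submodule.mem_bot, map_sub, sub_eq_zero, ← LinearMap.comp_apply, hq, eq_comm] at this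
  have hg_surj : Function.Surjective g := hσ.surjective_of_surjective_comp fun s =>
    let ⟨x, hx⟩ := hp s
    ⟨π x, (hgp x).trans hx⟩
  obtain ⟨b⟩ := CornerBasis.nonempty_of_injective H (.of_projective H S.projCover)
    (hM S.projCover g hg_surj hσ.projective)
  have hS_top := traceSub_eq_top_of_surjective S.projCoverMap hσ.surjective b.traceSub_eq_top
  refine Submodule.eq_top_iff'.2 fun x => (Submodule.Quotient.mk_eq_zero _).1 ?_
  exact (Submodule.mem_bot R).1
    (hS.symm.trans hS_top ▸ Submodule.mem_top : p x ∈ (⊥ : Submodule R S))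

end Presentation

end IsNakayamaKernel

/-! ### The translates as Nakayama kernels -/

namespace IsDualPairing

theorem isNakayamaKernel {K R S : Type*} [Field K] [Ring R] [Algebra K R] [Ring S] [Algebra K S]
    {ρ : R ≃ₗ[K] S} {P₁ P₀ T Y : Type*} [AddCommGroup P₁] [Module R P₁] [AddCommGroup P₀]
    [Module R P₀] [AddCommGroup T] [Module K T] [Module R T] [AddCommGroup Y] [Module K Y]
    [Module S Y] {E : T →ₗ[K] Y →ₗ[K] K} (h : IsDualPairing ρ E) (d : P₁ →ₗ[R] P₀)
    {q : (P₁ →ₗ[R] R) →ₗ[K] Y} (hq : Function.Surjective q)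
    (hqd : ∀ f, q f = 0 ↔ ∃ g : P₀ →ₗ[R] R, g ∘ₗ d = f)
    (hqs : ∀ r f, q (op r • f) = ρ r • q f) : IsNakayamaKernel d (E.compl₂ q) where
  injective := (injective_iff_map_eq_zero _).2 fun x hx => h.ext_left fun y => by
    obtain ⟨f, rfl⟩ := hq y
    rw [map_zero, LinearMap.zero_apply]
    exact LinearMap.congr_fun hx f
  mem_range_iff l := by
    constructor
    · rintro ⟨x, rfl⟩ f
      rw [LinearMap.compl₂_apply, (hqd _).2 ⟨f, rfl⟩, map_zero]
    · intro hl
      obtain ⟨s, hs⟩ := q.exists_rightInverse_of_surjective (LinearMap.range_eq_top.2 hq)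
      obtain ⟨x, hx⟩ := h.exists_apply_eq (l ∘ₗ s)
      refine ⟨x, LinearMap.ext fun f => ?_⟩
      obtain ⟨g, hg⟩ := (hqd (s (q f) - f)).1 <| by
        rw [map_sub, sub_eq_zero]
        exact LinearMap.congr_fun hs (q f)
      rw [LinearMap.compl₂_apply, hx, LinearMap.comp_apply, ← sub_eq_zero, ← map_sub, ← hg, hl]
  smul_apply r x f := by
    rw [LinearMap.compl₂_apply, LinearMap.compl₂_apply, h.smul_apply, hqs]

end IsDualPairing

namespace FDMod

variable {K A : Type u} [Field K] [Ring A] [Algebra K A]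

theorem exists_isDualPairing_dualOfLeft (M : FDMod K A) : ∃ B : M.dualOfLeft →ₗ[K] M →ₗ[K] K,
    IsDualPairing (opLinearEquiv K : A ≃ₗ[K] Aᵐᵒᵖ).symm B :=
  ⟨(.id : Module.Dual K M →ₗ[K] Module.Dual K M), fun _ _ => rfl, fun _ _ _ => rfl,
    inferInstanceAs (LinearMap.id : Module.Dual K M →ₗ[K] _).IsPerfPair⟩

theorem exists_isDualPairing_dualOfRight (M : FDMod K Aᵐᵒᵖ) :
    ∃ B : M.dualOfRight →ₗ[K] M →ₗ[K] K,
      IsDualPairing (opLinearEquiv K : A ≃ₗ[K] Aᵐᵒᵖ) B :=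
  ⟨(.id : Module.Dual K M →ₗ[K] Module.Dual K M), fun _ _ => rfl, fun _ _ _ => rfl,
    inferInstanceAs (LinearMap.id : Module.Dual K M →ₗ[K] _).IsPerfPair⟩

variable [FiniteDimensional K A]

theorem exists_isNakayamaKernel_tau (M : FDMod K Aᵐᵒᵖ) :
    ∃ i : M.tau →ₗ[K] (M.syzygy.projCover →ₗ[Aᵐᵒᵖ] Aᵐᵒᵖ) →ₗ[K] K,
      IsNakayamaKernel M.presentationMap i := by
  obtain ⟨E, hE⟩ := M.transposeOfRight.exists_isDualPairing_dualOfLeft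
  let N := LinearMap.range (LinearMap.lcomp A A M.presentationMap)
  let u : Aᵐᵒᵖ ≃ₗ[Aᵐᵒᵖ] A := (opLinearEquiv Aᵐᵒᵖ).symm
  let q : (M.syzygy.projCover →ₗ[Aᵐᵒᵖ] Aᵐᵒᵖ) →ₗ[K] M.transposeOfRight :=
    { toFun := fun f => N.mkQ (u.toLinearMap ∘ₗ f)
      map_add' := fun f g => by rw [LinearMap.comp_add, map_add]; rfl
      map_smul' := fun k f => congrArg N.mkQ rfl }
  refine ⟨_, hE.isNakayamaKernel M.presentationMap (q := q) (fun y => ?_) (fun f => ?_)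
    fun r f => rfl⟩
  · obtain ⟨g, rfl⟩ := N.mkQ_surjective y
    exact ⟨u.symm.toLinearMap ∘ₗ g, rfl⟩
  · refine (Submodule.Quotient.mk_eq_zero N).trans ⟨?_, ?_⟩
    · rintro ⟨g, hg⟩
      exact ⟨u.symm.toLinearMap ∘ₗ g,
        LinearMap.ext fun x => congrArg op (LinearMap.congr_fun hg x)⟩
    · rintro ⟨g, rfl⟩
      exact ⟨u.toLinearMap ∘ₗ g, rfl⟩

theorem exists_isNakayamaKernel_of_isDualPairing (M : FDMod K A) {T : FDMod K A}
    {E : T →ₗ[K] M.transposeOfLeft →ₗ[K] K}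
    (hE : IsDualPairing (opLinearEquiv K : A ≃ₗ[K] Aᵐᵒᵖ) E) :
    ∃ i : T →ₗ[K] (M.syzygy.projCover →ₗ[A] A) →ₗ[K] K,
      IsNakayamaKernel M.presentationMap i := by
  let N := LinearMap.range (LinearMap.lcomp Aᵐᵒᵖ A M.presentationMap)
  exact ⟨_, hE.isNakayamaKernel M.presentationMap (q := N.mkQ.restrictScalars K) N.mkQ_surjective
    (fun f => Submodule.Quotient.mk_eq_zero N) fun r f => rfl⟩

end FDMod

/-! ### Dominant dimension and the second syzygy -/

section Syzygy

variable {K R : Type u} [Field K] [Ring R] [Algebra K R] [FiniteDimensional K R]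

namespace FDMod

/-- The kernel of the minimal projective presentation of `M` is `Ω²(M)`. -/
noncomputable def kerPresentationMapEquiv (M : FDMod K R) :
    LinearMap.ker M.presentationMap ≃ₗ[R] M.syzygy.syzygy :=
  .ofEq _ _ (LinearMap.ker_comp_of_ker_eq_bot _ (Submodule.ker_subtype _))

theorem exact_presentationMap_projCoverMap (M : FDMod K R) :
    Function.Exact M.presentationMap M.projCoverMap :=
  LinearMap.exact_iff.2 <| ((LinearMap.range_comp_of_range_eq_top _ (LinearMap.range_eq_top.2
    M.syzygy.isProjectiveCover_projCoverMap.surjective)).trans (Submodule.range_subtype _)).symm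

theorem isCornerClosed_syzygy_syzygy {e : R} {t : R →ₗ[K] K} (H : IsSymmetricIdempotent K e t)
    (hR : IsCornerClosed K e R) (M : FDMod K R) : IsCornerClosed K e M.syzygy.syzygy := by
  have := M.isProjectiveCover_projCoverMap.projective
  have := M.syzygy.isProjectiveCover_projCoverMap.projective
  have : Module.Finite R M.projCover := .of_restrictScalars_finite K R _
  have : Module.Finite R M.syzygy.projCover := .of_restrictScalars_finite K R _
  have hker : IsCornerClosed K e (LinearMap.ker M.presentationMap) :=
    (hR.of_projective H M.syzygy.projCover).of_exact (.of_projective H M.projCover)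
      Subtype.val_injective (LinearMap.exact_subtype_ker_map M.presentationMap)
  exact hker.of_linearEquiv M.kerPresentationMapEquiv.symm

end FDMod

namespace IsDualPairing

variable {S : Type u} [Ring S] [Algebra K S] [FiniteDimensional K S] {ρ : S ≃ₗ[K] R} {e : R}
  {t : R →ₗ[K] K} {X : FDMod K S} {M T : FDMod K R} {B : X →ₗ[K] M →ₗ[K] K}
  {i : T →ₗ[K] (M.syzygy.projCover →ₗ[R] R) →ₗ[K] K}

theorem nonempty_equiv_of_two_le_domDim (h : IsDualPairing ρ B)
    (H : IsSymmetricIdempotent K e t) (hi : IsNakayamaKernel M.presentationMap i)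
    (hX : 2 ≤ X.domDim) : Nonempty (T ≃ₗ[R] M.syzygy.syzygy) := by
  obtain ⟨h₀, h₁⟩ := h.two_le_domDim_iff.1 hX
  have := M.isProjectiveCover_projCoverMap.projective
  have := M.syzygy.isProjectiveCover_projCoverMap.projective
  have : Module.Finite R M.projCover := .of_restrictScalars_finite K R _
  have : Module.Finite R M.syzygy.projCover := .of_restrictScalars_finite K R _
  obtain ⟨b₀⟩ := CornerBasis.nonempty_of_injective H (.of_projective H M.projCover) h₀
  obtain ⟨b₁⟩ := CornerBasis.nonempty_of_injective H (.of_projective H M.syzygy.projCover) h₁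
  exact (hi.nonempty_equiv_ker H b₁ b₀).map (·.trans M.kerPresentationMapEquiv)

theorem two_le_domDim_of_equiv (h : IsDualPairing ρ B) (H : IsSymmetricIdempotent K e t)
    (hR : IsCornerClosed K e R) (hi : IsNakayamaKernel M.presentationMap i)
    (hM : ∀ (Q : FDMod K R) (g : M →ₗ[R] Q), Function.Surjective g →
      Module.Projective R Q → Module.Injective R Q)
    (f : T ≃ₗ[R] M.syzygy.syzygy) : 2 ≤ X.domDim := by
  have hT : IsCornerClosed K e T := (M.isCornerClosed_syzygy_syzygy H hR).of_linearEquiv f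
  have hM₀ := M.isProjectiveCover_projCoverMap
  have := hM₀.projective
  have := M.syzygy.isProjectiveCover_projCoverMap.projective
  have : Module.Finite R M.projCover := .of_restrictScalars_finite K R _
  have : Module.Finite R M.syzygy.projCover := .of_restrictScalars_finite K R _
  have hd := M.exact_presentationMap_projCoverMap
  obtain ⟨b₁⟩ := CornerBasis.nonempty_of_traceSub_eq_top H.idem <|
    hi.traceSub_eq_top_of_isTorsionFree hT.torsionFree hM₀ hd.linearMap_comp_eq_zero
  obtain ⟨b₀⟩ := CornerBasis.nonempty_of_traceSub_eq_top H.idem <|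
    hi.traceSub_eq_top_of_isCornerClosed H hT b₁.dual.traceSub_eq_top hd hM₀.surjective hM
  exact h.two_le_domDim_iff.2 ⟨b₀.injective H, b₁.injective H⟩

end IsDualPairing

end Syzygy

/-! ### Projective and injective direct summands -/

theorem isCompl_range_ker_of_comp_eq_id {R M Q : Type*} [Ring R] [AddCommGroup M] [Module R M]
    [AddCommGroup Q] [Module R Q] {f : Q →ₗ[R] M} {g : M →ₗ[R] Q}
    (hgf : g ∘ₗ f = LinearMap.id) : IsCompl (LinearMap.range f) (LinearMap.ker g) := by
  have hgf' (x : Q) : g (f x) = x := LinearMap.congr_fun hgf x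
  refine ⟨Submodule.disjoint_def.2 ?_, codisjoint_iff.2 (Submodule.eq_top_iff'.2 fun x => ?_)⟩
  · rintro _ ⟨x, rfl⟩ hx
    rw [← hgf' x, LinearMap.mem_ker.1 hx, map_zero]
  · refine Submodule.mem_sup.2 ⟨f (g x), ⟨_, rfl⟩, x - f (g x), ?_, add_sub_cancel _ _⟩
    rw [LinearMap.mem_ker, map_sub, hgf', sub_self]

section Summands

variable {R : Type u} [Ring R] {M Q : Type u} [AddCommGroup M] [Module R M] [AddCommGroup Q]
  [Module R Q]

theorem injective_of_linearEquiv (f : M ≃ₗ[R] Q) (hM : Module.Injective R M) :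
    Module.Injective R Q :=
  injective_of_retract f.symm.toLinearMap f.toLinearMap f.apply_symm_apply hM

theorem injective_of_surjective_of_summands
    (hM : ∀ N L : Submodule R M, IsCompl N L → Module.Projective R N → Module.Injective R N)
    {g : M →ₗ[R] Q} (hg : Function.Surjective g) [Module.Projective R Q] :
    Module.Injective R Q := by
  obtain ⟨s, hs⟩ := Module.projective_lifting_property g LinearMap.id hg
  have hs_inj : Function.Injective s :=
    Function.LeftInverse.injective (LinearMap.congr_fun hs)
  let u : Q ≃ₗ[R] LinearMap.range s := .ofInjective s hs_inj
  exact injective_of_linearEquiv u.symm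
    (hM _ _ (isCompl_range_ker_of_comp_eq_id hs) (.of_equiv u))

theorem projective_of_injective_of_summands
    (hM : ∀ N L : Submodule R M, IsCompl N L → Module.Injective R N → Module.Projective R N)
    {f : Q →ₗ[R] M} (hf : Function.Injective f) (hQ : Module.Injective R Q) :
    Module.Projective R Q := by
  obtain ⟨r, hr⟩ := hQ.out f hf LinearMap.id
  let u : Q ≃ₗ[R] LinearMap.range f := .ofInjective f hf
  have := hM _ _ (isCompl_range_ker_of_comp_eq_id (LinearMap.ext hr))
    (injective_of_linearEquiv u hQ)
  exact .of_equiv u.symm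

theorem IsDualPairing.injective_of_surjective_of_summands {K R S : Type u} [Field K] [Ring R]
    [Algebra K R] [FiniteDimensional K R] [Ring S] [Algebra K S] [FiniteDimensional K S]
    {ρ : S ≃ₗ[K] R} {X : FDMod K S} {M : FDMod K R} {B : X →ₗ[K] M →ₗ[K] K}
    (h : IsDualPairing ρ B)
    (hX : ∀ N L : Submodule S X, IsCompl N L → Module.Injective S N → Module.Projective S N)
    {Q : FDMod K R} {g : M →ₗ[R] Q} (hg : Function.Surjective g) (hQ : Module.Projective R Q) :
    Module.Injective R Q := by
  obtain ⟨Y, B', h'⟩ := exists_isDualPairing h.flip.map_mul Q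
  exact h'.injective_iff_projective.2 <|
    projective_of_injective_of_summands hX (h.dualMap_injective h'.flip hg)
      (h'.flip.injective_iff_projective.2 hQ)

end Summands

/-! ### Gendo-symmetric algebras -/

section TraceForm

variable {K A : Type u} [Field K] [Ring A] [Algebra K A] [FiniteDimensional K A] {e : A}

/-- The functional on `Ae` that corresponds to an element of `eA` under `D(Ae) ≅ eA`. -/
def functionalOf (φ : (FDMod.of K A (leftIdeal e)).dualOfLeft ≃ₗ[Aᵐᵒᵖ] rightIdeal e)
    (x : rightIdeal e) : leftIdeal e →ₗ[K] K :=
  φ.symm x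

/-- The linear form on `A` that sends `a` to the value at `ae` of the functional on `Ae`
corresponding to `e ∈ eA` under `D(Ae) ≅ eA`. -/
noncomputable def traceForm
    (φ : (FDMod.of K A (leftIdeal e)).dualOfLeft ≃ₗ[Aᵐᵒᵖ] rightIdeal e) : A →ₗ[K] K :=
  functionalOf φ ((LinearMap.toSpanSingleton Aᵐᵒᵖ A e).rangeRestrict 1) ∘ₗ
    (LinearMap.toSpanSingleton A A e).rangeRestrict.restrictScalars K

variable (φ : (FDMod.of K A (leftIdeal e)).dualOfLeft ≃ₗ[Aᵐᵒᵖ] rightIdeal e)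

theorem functionalOf_apply (f : leftIdeal e →ₗ[K] K) : functionalOf φ (φ f) = f :=
  φ.symm_apply_apply f

theorem functionalOf_injective : Function.Injective (functionalOf φ) :=
  φ.symm.injective

theorem functionalOf_smul (a : A) (x : rightIdeal e) (y : leftIdeal e) :
    functionalOf φ (op a • x) y = functionalOf φ x (a • y) :=
  LinearMap.congr_fun (map_smul φ.symm (op a) x) y

theorem traceForm_mul (a b : A) : traceForm φ (a * b) =
    functionalOf φ ((LinearMap.toSpanSingleton Aᵐᵒᵖ A e).rangeRestrict (op a))
      ((LinearMap.toSpanSingleton A A e).rangeRestrict b) := by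
  rw [← mul_one (op a), ← smul_eq_mul (op a), map_smul, functionalOf_smul, ← map_smul]
  rfl

theorem traceForm_mul_right (he : IsIdempotentElem e) (a : A) :
    traceForm φ (a * e) = traceForm φ a :=
  congrArg (functionalOf φ _) (Subtype.ext ((mul_assoc a e e).trans (congrArg (a * ·) he)))

theorem traceForm_mul_left (he : IsIdempotentElem e) (a : A) :
    traceForm φ (e * a) = traceForm φ a := by
  have hr : (LinearMap.toSpanSingleton Aᵐᵒᵖ A e).rangeRestrict (op e) =
      (LinearMap.toSpanSingleton Aᵐᵒᵖ A e).rangeRestrict (op 1) :=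
    Subtype.ext (he.trans (mul_one e).symm)
  rw [traceForm_mul, hr, ← traceForm_mul, one_mul]

theorem traceForm_mul_mul_comm (he : IsIdempotentElem e)
    (hφ : ∀ (c : A) (f : leftIdeal e →ₗ[K] K),
      (φ (f ∘ₗ mulRightCorner K e c : leftIdeal e →ₗ[K] K) : A) = e * c * e * (φ f : A))
    (a b : A) : traceForm φ (a * e * b) = traceForm φ (b * e * a) := by
  let r : Aᵐᵒᵖ →ₗ[Aᵐᵒᵖ] rightIdeal e := (LinearMap.toSpanSingleton Aᵐᵒᵖ A e).rangeRestrict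
  have hcorner : functionalOf φ (r (op (a * e))) =
      functionalOf φ (r 1) ∘ₗ mulRightCorner K e a := by
    rw [← functionalOf_apply φ (functionalOf φ (r 1) ∘ₗ mulRightCorner K e a)]
    refine congrArg (functionalOf φ) (Subtype.ext ?_)
    rw [hφ, functionalOf, φ.apply_symm_apply]
    change e * (a * e) = e * a * e * (e * 1)
    simp only [mul_assoc, mul_one, he.eq]
  rw [traceForm_mul, hcorner, ← traceForm_mul_right φ he (b * e * a)]
  refine congrArg (functionalOf φ (r 1)) (Subtype.ext ?_)
  change b * e * (e * a * e) = b * e * a * e * e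
  simp only [mul_assoc, he.eq, he.mul_self_mul]

theorem mul_left_eq_zero_of_traceForm_eq_zero {x : A}
    (hx : ∀ y, traceForm φ (x * y) = 0) : e * x = 0 := by
  have hr : (LinearMap.toSpanSingleton Aᵐᵒᵖ A e).rangeRestrict (op x) = 0 :=
    functionalOf_injective φ <| LinearMap.ext fun y => by
      obtain ⟨y, rfl⟩ := LinearMap.surjective_rangeRestrict _ y
      rw [← traceForm_mul, hx]
      exact (LinearMap.congr_fun (map_zero φ.symm) _).symm
  exact congrArg Subtype.val hr

theorem mul_right_eq_zero_of_traceForm_eq_zero {y : A}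
    (hy : ∀ x, traceForm φ (x * y) = 0) : y * e = 0 := by
  have hl : (LinearMap.toSpanSingleton A A e).rangeRestrict y = 0 :=
    (Module.forall_dual_apply_eq_zero_iff K _).1 fun f => by
      obtain ⟨x, hx⟩ := LinearMap.surjective_rangeRestrict _ (φ f)
      rw [← functionalOf_apply φ f, ← hx, ← op_unop x, ← traceForm_mul, hy]
  exact congrArg Subtype.val hl

theorem DualIsoAsBimodule.exists_isSymmetricIdempotent (hD : DualIsoAsBimodule K e)
    (he : IsIdempotentElem e) (hf : FaithfulSMul Aᵐᵒᵖ (rightIdeal e)) :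
    ∃ t : A →ₗ[K] K, IsSymmetricIdempotent K e t := by
  obtain ⟨φ, hφ⟩ := hD
  refine ⟨traceForm φ, he, traceForm_mul_left φ he, traceForm_mul_right φ he,
    traceForm_mul_mul_comm φ he hφ, fun _ => mul_left_eq_zero_of_traceForm_eq_zero φ,
    fun _ => mul_right_eq_zero_of_traceForm_eq_zero φ,
    fun a ha => op_injective (hf.eq_of_smul_eq_smul fun x => ?_)⟩
  obtain ⟨x, rfl⟩ := LinearMap.surjective_rangeRestrict _ x
  exact Subtype.ext ((ha x.unop).trans (mul_zero (e * x.unop)).symm)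

end TraceForm

section DoubleCentralizer

variable {K R : Type*} [Field K] [Ring R] [Algebra K R] {e : R} {t : R →ₗ[K] K}

namespace IsSymmetricIdempotent

theorem exists_adjoint [FiniteDimensional K R] (H : IsSymmetricIdempotent K e t)
    {ψ : R →ₗ[K] R} (hψ : ∀ x, ψ (e * x) = e * ψ x) :
    ∃ ψ' : R →ₗ[K] R, (∀ r, ψ' r * e = ψ' r) ∧ ∀ r x, t (x * ψ' r) = t (ψ x * r) := by
  let l : R →ₗ[K] R →ₗ[K] K := ((LinearMap.mul K R).compr₂ t ∘ₗ ψ).flip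
  have hl (r x) : t (x * H.rep (l r)) = t (ψ x * r) := by
    rw [H.trace_mul_rep, ← H.left (ψ x * r), ← mul_assoc, ← hψ]
    rfl
  refine ⟨{ toFun := fun r => H.rep (l r)
            map_add' := fun a b => H.ext_right (H.rep_mul _)
              (by rw [add_mul, H.rep_mul, H.rep_mul]) fun x => ?_
            map_smul' := fun k a => H.ext_right (H.rep_mul _)
              (by rw [RingHom.id_apply, smul_mul_assoc, H.rep_mul]) fun x => ?_ },
    fun r => H.rep_mul _, hl⟩
  · rw [hl, mul_add x, map_add t, hl, hl, mul_add, map_add]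
  · rw [RingHom.id_apply, hl, mul_smul_comm, mul_smul_comm, map_smul t, map_smul t, hl]

theorem adjoint_mul_corner (H : IsSymmetricIdempotent K e t) {ψ ψ' : R →ₗ[K] R}
    (hψ : ∀ s x, ψ (e * s * e * x) = e * s * e * ψ x) (hψ'e : ∀ r, ψ' r * e = ψ' r)
    (hadj : ∀ r x, t (x * ψ' r) = t (ψ x * r)) (r s : R) :
    ψ' (r * (e * s * e)) = ψ' r * (e * s * e) := by
  refine H.ext_right (hψ'e _) (by simp only [mul_assoc, H.idem.eq]) fun x => ?_
  have hψs : e * ψ (s * e * x) = e * s * e * ψ x := by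
    have hψe := hψ 1 (s * e * x)
    rw [mul_one, H.idem.eq] at hψe
    rw [← hψe, ← hψ]
    simp only [mul_assoc]
  calc t (x * ψ' (r * (e * s * e))) = t (ψ x * (r * (e * s * e))) := hadj _ _
    _ = t (s * e * (ψ x * r)) := by
      rw [H.symm, ← H.right (_ * s)]; simp only [mul_assoc]
    _ = t (e * ψ (s * e * x) * r) := by rw [← H.left, hψs]; simp only [mul_assoc]
    _ = t (s * e * x * ψ' r) := by rw [hadj, mul_assoc, H.left]
    _ = t (x * (ψ' r * (e * s * e))) := by
      rw [mul_assoc, H.symm, ← H.right]; simp only [mul_assoc]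

/-- An `eRe`-endomorphism of `eR` has an adjoint on `Re` with respect to the trace form, and the
adjoint of the multiplication by an element of `R` is the multiplication by that element. -/
theorem isCornerClosed_self_of_op [FiniteDimensional K R] (H : IsSymmetricIdempotent K e t)
    (h : IsCornerClosed K (MulOpposite.op e) R) : IsCornerClosed K e R := by
  refine ⟨H.faithful, fun ψ hψ => ?_⟩
  have hψe (x) : ψ (e * x) = e * ψ x := by simpa only [mul_one, H.idem.eq, smul_eq_mul] using hψ 1 x
  obtain ⟨ψ', hψ'e, hadj⟩ := H.exists_adjoint hψe
  obtain ⟨a, ha⟩ := h.exists_eq (ψ' ∘ₗ (opLinearEquiv K).symm.toLinearMap) fun s r =>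
    (congrArg ψ' (by simp [mul_assoc])).trans
      ((H.adjoint_mul_corner hψ hψ'e hadj r.unop s.unop).trans (by simp [mul_assoc]))
  have hmul (r) : ψ' (r * e) = a * (r * e) := ha (MulOpposite.op r)
  refine ⟨a, fun x => H.ext_left (by rw [hψe, ← mul_assoc, H.idem]) ?_ fun r => ?_⟩
  · rw [smul_eq_mul, ← mul_assoc, ← mul_assoc, H.idem]
  calc t (ψ (e * x) * r) = t (ψ x * (r * e)) := by
        rw [hψe, mul_assoc, H.left, ← H.right, mul_assoc]
    _ = t (x * (a * (r * e))) := by rw [← hadj, hmul]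
    _ = t ((e * x) • a * r) := by
        rw [← H.left, ← H.right (_ * r), smul_eq_mul]; simp only [mul_assoc]

end IsSymmetricIdempotent

end DoubleCentralizer

section Translates

variable {K A : Type u} [Field K] [Ring A] [Algebra K A] [FiniteDimensional K A]

theorem FDMod.nonempty_tauInv_equiv_iff (M : FDMod K Aᵐᵒᵖ) :
    Nonempty (M.tauInv ≃ₗ[Aᵐᵒᵖ] M.cosyzygy.cosyzygy) ↔
      Nonempty (M.tauInv.dualOfRight ≃ₗ[A] M.dualOfRight.syzygy.syzygy) := by
  obtain ⟨_, hM⟩ := M.exists_isDualPairing_dualOfRight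
  obtain ⟨_, hT⟩ := M.tauInv.exists_isDualPairing_dualOfRight
  obtain ⟨_, hM₁⟩ := hM.flip.exists_cosyzygy_syzygy
  obtain ⟨_, hM₂⟩ := hM₁.exists_cosyzygy_syzygy
  exact hT.flip.nonempty_equiv_iff hM₂

end Translates

end GendoSymm

theorem mainTheorem10 {K : Type u} {A : Type u} [Field K] [Ring A] [Algebra K A]
    [FiniteDimensional K A] (hA : GendoSymm.IsGendoSymmetric K A)
    (M : GendoSymm.FDMod K Aᵐᵒᵖ) :
    ((2 ≤ M.codomDim → Nonempty (M.tau ≃ₗ[Aᵐᵒᵖ] M.syzygy.syzygy)) ∧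
      ((∀ N L : Submodule Aᵐᵒᵖ M, IsCompl N L →
          Module.Projective Aᵐᵒᵖ N → Module.Injective Aᵐᵒᵖ N) →
        (2 ≤ M.codomDim ↔ Nonempty (M.tau ≃ₗ[Aᵐᵒᵖ] M.syzygy.syzygy)))) ∧
    ((2 ≤ M.domDim → Nonempty (M.tauInv ≃ₗ[Aᵐᵒᵖ] M.cosyzygy.cosyzygy)) ∧
      ((∀ N L : Submodule Aᵐᵒᵖ M, IsCompl N L →
          Module.Injective Aᵐᵒᵖ N → Module.Projective Aᵐᵒᵖ N) →
        (2 ≤ M.domDim ↔ Nonempty (M.tauInv ≃ₗ[Aᵐᵒᵖ] M.cosyzygy.cosyzygy)))) := by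
  obtain ⟨hdom, e, he, hD⟩ := hA
  obtain ⟨t, H⟩ := hD.exists_isSymmetricIdempotent he.idempotent he.faithful
  have hA : GendoSymm.IsCornerClosed K (MulOpposite.op e) A :=
    GendoSymm.FDMod.isCornerClosed_of_two_le_domDim H.op hdom
  obtain ⟨_, hDM⟩ := M.exists_isDualPairing_dualOfRight
  constructor
  · obtain ⟨_, hτ⟩ := M.exists_isNakayamaKernel_tau
    refine ⟨hDM.nonempty_equiv_of_two_le_domDim H.op hτ, fun hM =>
      ⟨hDM.nonempty_equiv_of_two_le_domDim H.op hτ, fun ⟨f⟩ =>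
        hDM.two_le_domDim_of_equiv H.op (hA.of_linearEquiv (MulOpposite.opLinearEquiv Aᵐᵒᵖ).symm) hτ
          (fun _ _ hg _ => GendoSymm.injective_of_surjective_of_summands hM hg) f⟩⟩
  · obtain ⟨_, hDT⟩ := M.tauInv.exists_isDualPairing_dualOfRight
    obtain ⟨_, hτ⟩ := M.dualOfRight.exists_isNakayamaKernel_of_isDualPairing hDT
    rw [M.nonempty_tauInv_equiv_iff]
    refine ⟨hDM.flip.nonempty_equiv_of_two_le_domDim H hτ, fun hM =>
      ⟨hDM.flip.nonempty_equiv_of_two_le_domDim H hτ, fun ⟨f⟩ =>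
        hDM.flip.two_le_domDim_of_equiv H (H.isCornerClosed_self_of_op hA) hτ
          (fun _ _ => hDM.flip.injective_of_surjective_of_summands hM) f⟩⟩
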